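/- \textbf{Setting.} Let $\psi:\mathbb{R}\to\mathbb{C}$ be a wavelet: $\psi\in L^1\cap L^2(\mathbb{R})$, $\int\psi=0$, $\|\psi\|_2=1$ and $\int |\widehat\psi(\omega)|^2/|\omega|\,d\omega<\infty$. For $\lambda>0$ put $\psi_\lambda(x)=\lambda^{1/2}\psi(\lambda x)$, and define the wavelet invariants of a signal $g$ by $(Sg)(\lambda)=\|g*\psi_\lambda\|_2^2$. If $g$ is a compactly supported distribution (for instance one containing white noise), $g*\psi_\lambda$ is the convolution in the sense of distributions, and $\|g*\psi_\lambda\|_2=\infty$ if it is not a function in $L^2(\mathbb{R})$. \textbf{Classic MRA model.} Let $f\in L^2(\mathbb{R})$ be real-valued and compactly supported, $\sigma\ge 0$, $M\ge 1$, and let $$y_j(x)=f(x-t_j)+\varepsilon_j(x),\qquad 1\le j\le M,$$ where $t_1,\dots,t_M$ are independent, identically distributed real random variables such that almost surely $f(\cdot-t_j)$ is supported in $[-\frac12,\frac12]$, and $\varepsilon_1,\dots,\varepsilon_M$ are independent white noises on $[-\frac12,\frac12]$ with variance $\sigma^2$, that is, $\varepsilon_j=dB^{(j)}$ is the distributional derivative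 on $[-\frac12,\frac12]$ of a Brownian motion $B^{(j)}$ with variance $\sigma^2$; the translations $(t_j)_j$ are independent of the noises $(\varepsilon_j)_j$. \textbf{Proposition.} Let $\lambda>0$. Each $(Sy_j)(\lambda)$ is an almost surely finite random variable, and the estimator $$(\widetilde{Sf})(\lambda):=\frac1M\sum_{j=1}^M (Sy_j)(\lambda)-\sigma^2$$ satisfies, for every $t>0$, with probability at least $1-1/t^2$, $$\bigl|(Sf)(\lambda)-(\widetilde{Sf})(\lambda)\bigr|\le \frac{2t\sigma}{\sqrt M}\bigl(\|f\|_1+\sigma\bigr).$$ -/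

import Mathlib

open MeasureTheory ProbabilityTheory
open scoped ENNReal NNReal

namespace MRA

/-- The dilation `ψ_λ(x) = λ^{1/2} ψ(λ x)`. -/
noncomputable def dilate (ψ : ℝ → ℂ) (lam : ℝ) (x : ℝ) : ℂ :=
  (Real.sqrt lam : ℂ) * ψ (lam * x)

/-- The Fourier transform with the convention `ψ̂(ξ) = ∫ ψ(x) e^{-i x ξ} dx`. -/
noncomputable def fourierHat (ψ : ℝ → ℂ) (ξ : ℝ) : ℂ :=
  ∫ x : ℝ, ψ x * Complex.exp (-(Complex.I * x * ξ))

/-- Wavelets: `ψ ∈ L¹ ∩ L²(ℝ)`, real or complex valued, of zero average, with `‖ψ‖₂ = 1` and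
the classic admissibility condition `∫ |ψ̂(ξ)|² / |ξ| dξ < ∞`. -/
structure IsWavelet (ψ : ℝ → ℂ) : Prop where
  integrable : Integrable ψ volume
  memLp_two : MemLp ψ 2 volume
  integral_eq_zero : ∫ x, ψ x = 0
  norm_eq_one : eLpNorm ψ 2 volume = 1
  admissible : Integrable (fun ξ : ℝ => ‖fourierHat ψ ξ‖ ^ 2 / |ξ|) volume

/-- The wavelet coefficient `(f ∗ ψ_λ)(u) = ∫ f(x) ψ_λ(u - x) dx` of a function. -/
noncomputable def waveletTransform (ψ : ℝ → ℂ) (lam : ℝ) (f : ℝ → ℝ) (u : ℝ) : ℂ :=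
  ∫ x : ℝ, (f x : ℂ) * dilate ψ lam (u - x)

/-- The wavelet invariant `(S f)(λ) = ‖f ∗ ψ_λ‖₂²` of a function `f ∈ L¹ ∩ L²`. -/
noncomputable def waveletInvariant (ψ : ℝ → ℂ) (lam : ℝ) (f : ℝ → ℝ) : ℝ :=
  ∫ u : ℝ, ‖waveletTransform ψ lam f u‖ ^ 2

/-! Signals containing white noise are not functions but distributions of compact support.
Such a signal is given by its pairing `T : (ℝ → ℂ) → ℂ` with smooth functions. -/

/-- The pairing `⟨f, χ⟩ = ∫ f χ` of a function, seen as a distribution. -/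
noncomputable def functionPairing (f : ℝ → ℝ) (χ : ℝ → ℂ) : ℂ :=
  ∫ x : ℝ, (f x : ℂ) * χ x

/-- The derivative `db` on `[-1/2, 1/2]` of a (merely continuous) path `b`, as a distribution:
`⟨db, χ⟩ = ∫_{-1/2}^{1/2} χ db`, which by definition (integration by parts) is
`χ(1/2) b(1/2) - χ(-1/2) b(-1/2) - ∫_{-1/2}^{1/2} χ'(x) b(x) dx`. -/
noncomputable def derivPairing (b : ℝ → ℝ) (χ : ℝ → ℂ) : ℂ :=
  χ (1 / 2) * (b (1 / 2) : ℂ) - χ (-1 / 2) * (b (-1 / 2) : ℂ)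
    - ∫ x in (-1 / 2 : ℝ)..(1 / 2), deriv χ x * (b x : ℂ)

/-- The convolution `T ∗ ψ_λ` of a distribution with the dilated wavelet, again a distribution:
`⟨T ∗ ψ_λ, φ⟩ = ⟨T, x ↦ ∫ ψ_λ(u - x) φ(u) du⟩`. -/
noncomputable def waveletConv (ψ : ℝ → ℂ) (lam : ℝ) (T : (ℝ → ℂ) → ℂ) (φ : ℝ → ℂ) : ℂ :=
  T (fun x => ∫ u : ℝ, dilate ψ lam (u - x) * φ u)

/-- The function `g ∈ L²(ℝ)` represents the distribution `U`. -/
def IsL2Rep (g : ℝ → ℂ) (U : (ℝ → ℂ) → ℂ) : Prop :=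
  MemLp g 2 volume ∧
    ∀ φ : ℝ → ℂ, ContDiff ℝ (⊤ : ℕ∞) φ → HasCompactSupport φ → ∫ u : ℝ, g u * φ u = U φ

/-- The wavelet invariant `(S T)(λ) = ‖T ∗ ψ_λ‖₂²` of a distribution `T`: it is `∫ |g|²` if
`T ∗ ψ_λ` is the function `g ∈ L²` (unique up to null sets), and `∞` if there is no such `g`. -/
noncomputable def waveletInvariantDist (ψ : ℝ → ℂ) (lam : ℝ) (T : (ℝ → ℂ) → ℂ) : ℝ≥0∞ :=
  ⨅ (g : ℝ → ℂ) (_ : IsL2Rep g (waveletConv ψ lam T)), ∫⁻ u : ℝ, ‖g u‖ₑ ^ 2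

/-- The path on `[-1/2, 1/2]` of the Brownian motion with variance `σ²`, started at `-1/2`,
that is obtained from a path of standard Brownian motion. -/
noncomputable def noisePath (σ : ℝ) (B : ℝ≥0 → ℝ) (x : ℝ) : ℝ :=
  σ * B (Real.toNNReal (x + 1 / 2))

/-- The observation `y(x) = f(x - τ) + ε(x)`, where `ε` is the derivative on `[-1/2, 1/2]` of the
Brownian path of variance `σ²`. -/
noncomputable def observation (f : ℝ → ℝ) (σ τ : ℝ) (B : ℝ≥0 → ℝ) (χ : ℝ → ℂ) : ℂ :=
  functionPairing (fun x => f (x - τ)) χ + derivPairing (noisePath σ B) χ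

/-- The classic MRA model: hidden signal `f`, noise level `σ`, random translations `τ j`,
and Brownian motions `B j` that drive the white noises. -/
structure IsClassicMRA {Ω : Type*} [MeasurableSpace Ω] (P : Measure Ω) {M : ℕ}
    (f : ℝ → ℝ) (σ : ℝ) (τ : Fin M → Ω → ℝ) (B : Fin M → ℝ≥0 → Ω → ℝ) : Prop where
  signal_memLp : MemLp f 2 volume
  signal_hasCompactSupport : HasCompactSupport f
  sigma_nonneg : 0 ≤ σ
  translation_measurable : ∀ j, Measurable (τ j)
  translation_identDistrib : ∀ i j, IdentDistrib (τ i) (τ j) P P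
  translation_indep : iIndepFun τ P
  /-- almost surely, the translated signals vanish (a.e.) outside `[-1/2, 1/2]` -/
  support_subset : ∀ j, ∀ᵐ ω ∂P, ∀ᵐ x : ℝ, x ∉ Set.Icc (-1 / 2 : ℝ) (1 / 2) → f (x - τ j ω) = 0
  noise_measurable : ∀ j s, Measurable (B j s)
  noise_brownian : ∀ j, IsBrownianReal (B j) P
  noise_indep : iIndepFun (fun j ω s => B j s ω) P
  /-- the translations are independent of the noises -/
  translation_noise_indep : IndepFun (fun ω j => τ j ω) (fun ω j s => B j s ω) P

/-- The estimator `(1/M) ∑_j (S y_j)(λ) - σ²` of `(S f)(λ)`. -/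
noncomputable def estimator {Ω : Type*} {M : ℕ} (ψ : ℝ → ℂ) (lam : ℝ) (f : ℝ → ℝ) (σ : ℝ)
    (τ : Fin M → Ω → ℝ) (B : Fin M → ℝ≥0 → Ω → ℝ) (ω : Ω) : ℝ :=
  (1 / (M : ℝ)) * ∑ j : Fin M,
    (waveletInvariantDist ψ lam (observation f σ (τ j ω) (fun s => B j s ω))).toReal - σ ^ 2

end MRA

/-! Let `A` be the class of `f ∗ ψ_λ` in `L²(ℝ)`. Then `y_j ∗ ψ_λ` is the random `L²` vector formed
by the translate of `A` by `τ j` plus the stochastic integral of `x ↦ σ · translate x ψ_λ` against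
`dB` on `[-1/2, 1/2]`. Translation preserves norms and `‖ψ_λ‖₂ = 1`, so its squared norm has mean
`‖A‖² + σ²`, which explains the correction by `σ²`, and variance at most `4‖A‖²σ² + 2σ⁴`. Since `‖A‖
≤ ‖f‖₁`, averaging `M` independent copies and applying Chebyshev's inequality gives the bound.

No stochastic integration theory is used. Left Riemann sums replace the integral: they are
Hilbert-valued walks with independent Gaussian increments, and `integral_walk_sub_sq_le` bounds
their moments by induction, uniformly in the mesh. Along dyadic grids that refine fast enough they
converge almost surely in `L²` (`ae_exists_tendsto_noisyWalk`), and the limit represents the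
distribution (`waveletInvariantDist_of_tendsto`), because Riemann sums against a smooth function
converge pathwise. Independence and centring are used before the limit only; Fatou's lemma in
`one_sub_le_measureReal_of_tendsto` carries the second moment across. -/

namespace MRA

/-! ### Moments of the centred Gaussian law up to order four. -/

section GaussianMoments

lemma integrable_pow_gaussianReal (s : ℝ≥0) (n : ℕ) :
    Integrable (fun x : ℝ => x ^ n) (gaussianReal 0 s) := by
  simpa using (memLp_id_gaussianReal (μ := 0) (v := s) n).integrable_norm_pow'.mono'
    (by fun_prop) (by simp)

lemma integral_pow_three_gaussianReal (s : ℝ≥0) :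
    ∫ x : ℝ, x ^ 3 ∂gaussianReal 0 s = 0 := by
  have h : ∫ x : ℝ, x ^ 3 ∂gaussianReal 0 s = -∫ x : ℝ, x ^ 3 ∂gaussianReal 0 s := by
    conv_lhs => rw [← neg_zero, ← gaussianReal_map_neg]
    rw [integral_map (by fun_prop) (by fun_prop), ← integral_neg]
    congr 1; ext x; ring
  linarith

lemma integral_sq_gaussianReal (s : ℝ≥0) :
    ∫ x : ℝ, x ^ 2 ∂gaussianReal 0 s = s := by
  have h := variance_eq_sub (memLp_id_gaussianReal (μ := 0) (v := s) 2)
  rw [variance_id_gaussianReal] at h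
  simpa using h.symm

/-- Differentiating `p(x) exp(s x² / 2)` replaces `p` by `p' + s x p`. Four steps from `p = 1`, the
moment generating function, leave the value `3 s²` at `0`. -/
lemma integral_pow_four_gaussianReal (s : ℝ≥0) :
    ∫ x : ℝ, x ^ 4 ∂gaussianReal 0 s = 3 * (s : ℝ) ^ 2 := by
  have hd : ∀ p p' : ℝ → ℝ, (∀ x, HasDerivAt p (p' x) x) →
      deriv (fun x => p x * Real.exp (s * x ^ 2 / 2)) =
        fun x => (p' x + p x * (s * x)) * Real.exp (s * x ^ 2 / 2) := by
    intro p p' hp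
    ext x
    have h1 : HasDerivAt (fun x : ℝ => (s : ℝ) * x ^ 2 / 2) (s * x) x := by
      have := ((hasDerivAt_pow 2 x).const_mul (s : ℝ)).div_const 2
      exact this.congr_deriv (by push_cast; ring)
    have h2 := ((hp x).fun_mul h1.exp).deriv
    rw [h2]; ring
  have h := iteratedDeriv_mgf_zero (X := id) (μ := gaussianReal 0 s) (by simp) 4
  have h0 : mgf id (gaussianReal 0 s) = fun x => 1 * Real.exp (s * x ^ 2 / 2) := by
    rw [mgf_id_gaussianReal]; simp
  simp only [iteratedDeriv_succ, iteratedDeriv_zero, h0] at h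
  rw [hd _ (fun _ => 0) (fun x => hasDerivAt_const _ _),
    hd _ (fun _ => s) (fun x => by simpa using (hasDerivAt_id x).const_mul (s : ℝ)),
    hd _ (fun x => 2 * s ^ 2 * x) (fun x => by
      have := (((hasDerivAt_pow 2 x).const_mul ((s : ℝ) ^ 2))).const_add (s : ℝ)
      refine (this.congr_deriv (by push_cast; ring)).congr_of_eventuallyEq
        (Filter.Eventually.of_forall fun y => by ring)),
    hd _ (fun x => 3 * s ^ 2 + 3 * s ^ 3 * x ^ 2) (fun x => by
      have := ((hasDerivAt_id x).const_mul (3 * (s : ℝ) ^ 2)).add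
        ((hasDerivAt_pow 3 x).const_mul ((s : ℝ) ^ 3))
      refine (this.congr_deriv (by push_cast; ring)).congr_of_eventuallyEq
        (Filter.Eventually.of_forall fun y => by simp; ring))] at h
  simpa using h.symm

end GaussianMoments

/-! ### Hilbert-valued walks driven by independent Gaussian increments. -/

section Increments

variable {Ω : Type*} {E : Type*} [NormedAddCommGroup E] [InnerProductSpace ℂ E]

/-- The increment `Δ i` is a centred Gaussian variable of variance `s`, independent of
`T` and of the preceding increments. -/
structure IsGaussianIncrements [MeasurableSpace Ω] (P : Measure Ω) (T : Ω → ℝ) (Δ : ℕ → Ω → ℝ) (s : ℝ≥0) : Prop where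
  measurable_fst : Measurable T
  measurable : ∀ i, Measurable (Δ i)
  hasLaw : ∀ i, HasLaw (Δ i) (gaussianReal 0 s) P
  indepFun : ∀ i, IndepFun (Δ i) (fun ω => (T ω, fun k : Fin i => Δ k ω)) P

/-- The random vector `a(T) + ∑_{i < m} Δ_i w_i`. -/
noncomputable def walk (a : ℝ → E) (w : ℕ → E) (T : Ω → ℝ) (Δ : ℕ → Ω → ℝ) (m : ℕ) (ω : Ω) : E :=
  a (T ω) + ∑ i ∈ Finset.range m, (Δ i ω : ℂ) • w i

lemma walk_succ (a : ℝ → E) (w : ℕ → E) (T : Ω → ℝ) (Δ : ℕ → Ω → ℝ) (m : ℕ) (ω : Ω) :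
    walk a w T Δ (m + 1) ω = walk a w T Δ m ω + (Δ m ω : ℂ) • w m := by
  simp [walk, Finset.sum_range_succ, add_assoc]

/-- Factoring through finitely many real variables yields measurability and independence of real
functions of the walk without a σ-algebra on `E`. -/
lemma exists_continuous_walk {a : ℝ → E} (ha : Continuous a) (w : ℕ → E) (T : Ω → ℝ)
    (Δ : ℕ → Ω → ℝ) (m : ℕ) :
    ∃ G : ℝ × (Fin m → ℝ) → E, Continuous G ∧
      ∀ ω, walk a w T Δ m ω = G (T ω, fun k : Fin m => Δ k ω) := by
  refine ⟨fun p => a p.1 + ∑ k : Fin m, (p.2 k : ℂ) • w k, by fun_prop, fun ω => ?_⟩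
  simp [walk, Finset.sum_range]

/-- Arranged in powers of `d` (hence `d ^ 1`) so that, for `d` independent of `y`, each term has the
shape required by `integral_pow_mul`. -/
lemma norm_add_smul_sq (y w : E) (d : ℝ) :
    ‖y + (d : ℂ) • w‖ ^ 2 = ‖y‖ ^ 2 + d ^ 1 * (2 * RCLike.re (inner ℂ y w)) + d ^ 2 * ‖w‖ ^ 2 := by
  rw [norm_add_sq (𝕜 := ℂ), inner_smul_right, norm_smul]
  simp [mul_pow]; ring

lemma re_inner_sq_le (y w : E) : RCLike.re (inner ℂ y w) ^ 2 ≤ ‖y‖ ^ 2 * ‖w‖ ^ 2 := by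
  rw [← mul_pow]
  exact sq_le_sq' (neg_le_of_abs_le ((RCLike.abs_re_le_norm _).trans (norm_inner_le_norm _ _)))
    ((RCLike.re_le_norm _).trans (norm_inner_le_norm _ _))

variable [MeasurableSpace Ω] {P : Measure Ω} {T : Ω → ℝ} {Δ : ℕ → Ω → ℝ} {s : ℝ≥0}

namespace IsGaussianIncrements

lemma measurable_comp_walk (h : IsGaussianIncrements P T Δ s) {a : ℝ → E} (ha : Continuous a)
    (w : ℕ → E) (m : ℕ) {g : E → ℝ} (hg : Continuous g) :
    Measurable fun ω => g (walk a w T Δ m ω) := by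
  obtain ⟨G, hG, hGe⟩ := exists_continuous_walk ha w T Δ m
  simp_rw [hGe]
  exact (hg.comp hG).measurable.comp
    (h.measurable_fst.prodMk (measurable_pi_lambda _ fun k => h.measurable k))

lemma indepFun_walk (h : IsGaussianIncrements P T Δ s) {a : ℝ → E} (ha : Continuous a)
    (w : ℕ → E) (m : ℕ) {g : E → ℝ} (hg : Continuous g) :
    IndepFun (Δ m) (fun ω => g (walk a w T Δ m ω)) P := by
  obtain ⟨G, hG, hGe⟩ := exists_continuous_walk ha w T Δ m
  simp_rw [hGe]
  exact (h.indepFun m).comp measurable_id (hg.comp hG).measurable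

lemma integrable_pow (h : IsGaussianIncrements P T Δ s) (i n : ℕ) :
    Integrable (fun ω => Δ i ω ^ n) P := by
  have := integrable_pow_gaussianReal s n
  rw [← (h.hasLaw i).map_eq] at this
  exact this.comp_measurable (h.measurable i)

lemma integral_pow (h : IsGaussianIncrements P T Δ s) (i n : ℕ) :
    ∫ ω, Δ i ω ^ n ∂P = ∫ x : ℝ, x ^ n ∂gaussianReal 0 s := by
  rw [← (h.hasLaw i).map_eq, integral_map (h.measurable i).aemeasurable (by fun_prop)]

lemma integrable_pow_mul (h : IsGaussianIncrements P T Δ s) {a : ℝ → E} (ha : Continuous a)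
    (w : ℕ → E) (m n : ℕ) {g : E → ℝ} (hg : Continuous g)
    (hi : Integrable (fun ω => g (walk a w T Δ m ω)) P) :
    Integrable (fun ω => Δ m ω ^ n * g (walk a w T Δ m ω)) P :=
  ((h.indepFun_walk ha w m hg).comp (measurable_id.pow_const n) measurable_id).integrable_mul
    (h.integrable_pow m n) hi

lemma integral_pow_mul (h : IsGaussianIncrements P T Δ s) {a : ℝ → E} (ha : Continuous a)
    (w : ℕ → E) (m n : ℕ) {g : E → ℝ} (hg : Continuous g) :
    ∫ ω, Δ m ω ^ n * g (walk a w T Δ m ω) ∂P =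
      (∫ x : ℝ, x ^ n ∂gaussianReal 0 s) * ∫ ω, g (walk a w T Δ m ω) ∂P := by
  rw [← h.integral_pow m n]
  exact ((h.indepFun_walk ha w m hg).comp (measurable_id.pow_const n)
    measurable_id).integral_mul_eq_mul_integral
    ((h.measurable m).pow_const n).aestronglyMeasurable
    (h.measurable_comp_walk ha w m hg).aestronglyMeasurable

variable [IsProbabilityMeasure P]

lemma integrable_re_inner (h : IsGaussianIncrements P T Δ s) {a : ℝ → E} (ha : Continuous a)
    (w : ℕ → E) (m : ℕ) (v : E) (hi : Integrable (fun ω => ‖walk a w T Δ m ω‖ ^ 2) P) :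
    Integrable (fun ω => RCLike.re (inner ℂ (walk a w T Δ m ω) v) ^ 2) P ∧
    Integrable (fun ω => RCLike.re (inner ℂ (walk a w T Δ m ω) v)) P := by
  have hm := h.measurable_comp_walk (g := fun y => RCLike.re (inner ℂ y v)) ha w m (by fun_prop)
  have h2 : Integrable (fun ω => RCLike.re (inner ℂ (walk a w T Δ m ω) v) ^ 2) P := by
    refine (hi.mul_const (‖v‖ ^ 2)).mono' (hm.pow_const 2).aestronglyMeasurable
      (ae_of_all _ fun ω => ?_)
    rw [Real.norm_of_nonneg (sq_nonneg _)]
    exact re_inner_sq_le _ _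
  exact ⟨h2, ((memLp_two_iff_integrable_sq hm.aestronglyMeasurable).2 h2).integrable one_le_two⟩

/-- The cross term vanishes in the mean: the new increment is centred and independent of the walk so
far. The weights are arbitrary, so this also covers differences of Riemann sums. -/
lemma integral_norm_walk_sq (h : IsGaussianIncrements P T Δ s) {a : ℝ → E} (ha : Continuous a)
    {α : ℝ} (hα : ∀ x, ‖a x‖ = α) (w : ℕ → E) (m : ℕ) :
    Integrable (fun ω => ‖walk a w T Δ m ω‖ ^ 2) P ∧
      ∫ ω, ‖walk a w T Δ m ω‖ ^ 2 ∂P = α ^ 2 + s * ∑ i ∈ Finset.range m, ‖w i‖ ^ 2 := by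
  induction m with
  | zero => simp [walk, hα]
  | succ m ih =>
    obtain ⟨ih1, ih2⟩ := ih
    obtain ⟨-, hL⟩ := h.integrable_re_inner ha w m (w m) ih1
    have hc : Continuous fun y : E => 2 * RCLike.re (inner ℂ y (w m)) := by fun_prop
    have hi := h.integrable_pow_mul ha w m 1 hc (hL.const_mul 2)
    have hi2 := (h.integrable_pow m 2).mul_const (‖w m‖ ^ 2)
    simp_rw [walk_succ, norm_add_smul_sq]
    have hi1 : Integrable (fun ω => ‖walk a w T Δ m ω‖ ^ 2 +
        Δ m ω ^ 1 * (2 * RCLike.re (inner ℂ (walk a w T Δ m ω) (w m)))) P := ih1.add hi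
    refine ⟨hi1.add hi2, ?_⟩
    rw [integral_add hi1 hi2, integral_add ih1 hi, ih2,
      h.integral_pow_mul ha w m 1 hc, integral_mul_const, h.integral_pow,
      integral_sq_gaussianReal, Finset.sum_range_succ]
    simp [integral_id_gaussianReal]
    ring

/-- Let `X` be the centred squared norm after `m` steps and `L = Re ⟨walk, w m⟩`. One more step adds
exactly `4 s E[L²] + 2 r⁴ s²` to `E[X²]`, and Cauchy–Schwarz gives `E[L²] ≤ (α² + s m r²) r²`. The
increments sum to the stated bound because `(m + 1)² - m² = 2m + 1`. -/
lemma integral_walk_sub_sq_le (h : IsGaussianIncrements P T Δ s) {a : ℝ → E} (ha : Continuous a)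
    {α : ℝ} (hα : ∀ x, ‖a x‖ = α) {w : ℕ → E} {r : ℝ} (hw : ∀ i, ‖w i‖ = r) (m : ℕ) :
    MemLp (fun ω => ‖walk a w T Δ m ω‖ ^ 2 - (α ^ 2 + s * (m * r ^ 2))) 2 P ∧
    ∫ ω, (‖walk a w T Δ m ω‖ ^ 2 - (α ^ 2 + s * (m * r ^ 2))) ∂P = 0 ∧
    ∫ ω, (‖walk a w T Δ m ω‖ ^ 2 - (α ^ 2 + s * (m * r ^ 2))) ^ 2 ∂P ≤
      4 * α ^ 2 * r ^ 2 * (s * m) + 2 * r ^ 4 * (s * m) ^ 2 := by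
  have hmean : ∀ m : ℕ, ∫ ω, (‖walk a w T Δ m ω‖ ^ 2 - (α ^ 2 + s * (m * r ^ 2))) ∂P = 0 := by
    intro m
    obtain ⟨h1, h2⟩ := h.integral_norm_walk_sq ha hα w m
    rw [integral_sub h1 (integrable_const _), h2]
    simp [hw]
  suffices H : MemLp (fun ω => ‖walk a w T Δ m ω‖ ^ 2 - (α ^ 2 + s * (m * r ^ 2))) 2 P ∧
      ∫ ω, (‖walk a w T Δ m ω‖ ^ 2 - (α ^ 2 + s * (m * r ^ 2))) ^ 2 ∂P ≤
        4 * α ^ 2 * r ^ 2 * (s * m) + 2 * r ^ 4 * (s * m) ^ 2 from ⟨H.1, hmean m, H.2⟩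
  have hmeas : ∀ m : ℕ, ∀ c : ℝ,
      AEStronglyMeasurable (fun ω => ‖walk a w T Δ m ω‖ ^ 2 - c) P := fun m c =>
    (h.measurable_comp_walk (g := fun y => ‖y‖ ^ 2 - c) ha w m
      (by fun_prop)).aestronglyMeasurable
  induction m with
  | zero => simp [walk, hα]
  | succ m ih =>
    obtain ⟨hX, ih2⟩ := ih
    have hX0 := hmean m
    obtain ⟨hY, hYi⟩ := h.integral_norm_walk_sq ha hα w m
    obtain ⟨hL2, hL⟩ := h.integrable_re_inner ha w m (w m) hY
    have hXsq := hX.integrable_sq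
    have hX1 := hX.integrable one_le_two
    have hLL := (memLp_two_iff_integrable_sq hL.1).2 hL2
    have hXL := hX.integrable_mul hLL
    have hL2i : ∫ ω, RCLike.re (inner ℂ (walk a w T Δ m ω) (w m)) ^ 2 ∂P ≤
        (α ^ 2 + s * (m * r ^ 2)) * r ^ 2 := by
      have h1 := integral_mono hL2 (hY.mul_const (r ^ 2)) (fun ω => by
        have := re_inner_sq_le (walk a w T Δ m ω) (w m)
        rwa [hw] at this)
      rw [integral_mul_const, hYi] at h1
      simpa [hw] using h1
    set c : ℝ := α ^ 2 + s * (m * r ^ 2) with hc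
    -- Polynomial in `Δ m` with coefficients depending on the walk at time `m`; the moments `0, s,
    -- 0, 3s²` then give the expectation.
    have hexp : ∀ ω, (‖walk a w T Δ (m + 1) ω‖ ^ 2 - (α ^ 2 + s * ((m + 1 : ℕ) * r ^ 2))) ^ 2 =
        ((‖walk a w T Δ m ω‖ ^ 2 - c) ^ 2 - 2 * r ^ 2 * s * (‖walk a w T Δ m ω‖ ^ 2 - c)
            + r ^ 4 * s ^ 2)
        + Δ m ω ^ 1 * ((fun y : E => 4 * ((‖y‖ ^ 2 - c) * RCLike.re (inner ℂ y (w m)))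
            - 4 * r ^ 2 * s * RCLike.re (inner ℂ y (w m))) (walk a w T Δ m ω))
        + Δ m ω ^ 2 * ((fun y : E => 2 * r ^ 2 * (‖y‖ ^ 2 - c)
            + 4 * RCLike.re (inner ℂ y (w m)) ^ 2 - 2 * r ^ 4 * s) (walk a w T Δ m ω))
        + Δ m ω ^ 3 * ((fun y : E => 4 * r ^ 2 * RCLike.re (inner ℂ y (w m)))
            (walk a w T Δ m ω))
        + Δ m ω ^ 4 * r ^ 4 := by
      intro ω
      rw [walk_succ, norm_add_smul_sq, hw, hc]
      push_cast
      ring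
    have k0 : Integrable (fun ω => (‖walk a w T Δ m ω‖ ^ 2 - c) ^ 2
        - 2 * r ^ 2 * s * (‖walk a w T Δ m ω‖ ^ 2 - c)) P := hXsq.sub (hX1.const_mul _)
    have i0 : Integrable (fun ω => (‖walk a w T Δ m ω‖ ^ 2 - c) ^ 2
        - 2 * r ^ 2 * s * (‖walk a w T Δ m ω‖ ^ 2 - c) + r ^ 4 * s ^ 2) P :=
      k0.add (integrable_const _)
    have j1 : Integrable (fun ω => 4 * ((‖walk a w T Δ m ω‖ ^ 2 - c)
        * RCLike.re (inner ℂ (walk a w T Δ m ω) (w m)))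
        - 4 * r ^ 2 * s * RCLike.re (inner ℂ (walk a w T Δ m ω) (w m))) P :=
      (hXL.const_mul 4).sub (hL.const_mul _)
    have j2' : Integrable (fun ω => 2 * r ^ 2 * (‖walk a w T Δ m ω‖ ^ 2 - c)
        + 4 * RCLike.re (inner ℂ (walk a w T Δ m ω) (w m)) ^ 2) P :=
      (hX1.const_mul _).add (hL2.const_mul 4)
    have i1 := h.integrable_pow_mul ha w m 1 (g := fun y : E => 4 * ((‖y‖ ^ 2 - c)
      * RCLike.re (inner ℂ y (w m))) - 4 * r ^ 2 * s * RCLike.re (inner ℂ y (w m)))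
      (by fun_prop) j1
    have e1 := h.integral_pow_mul ha w m 1 (g := fun y : E => 4 * ((‖y‖ ^ 2 - c)
      * RCLike.re (inner ℂ y (w m))) - 4 * r ^ 2 * s * RCLike.re (inner ℂ y (w m))) (by fun_prop)
    have i2 := h.integrable_pow_mul ha w m 2 (g := fun y : E => 2 * r ^ 2 * (‖y‖ ^ 2 - c)
      + 4 * RCLike.re (inner ℂ y (w m)) ^ 2 - 2 * r ^ 4 * s) (by fun_prop)
      (j2'.sub (integrable_const _))
    have e2 := h.integral_pow_mul ha w m 2 (g := fun y : E => 2 * r ^ 2 * (‖y‖ ^ 2 - c)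
      + 4 * RCLike.re (inner ℂ y (w m)) ^ 2 - 2 * r ^ 4 * s) (by fun_prop)
    have i3 := h.integrable_pow_mul ha w m 3 (g := fun y : E =>
      4 * r ^ 2 * RCLike.re (inner ℂ y (w m))) (by fun_prop) (hL.const_mul _)
    have e3 := h.integral_pow_mul ha w m 3 (g := fun y : E =>
      4 * r ^ 2 * RCLike.re (inner ℂ y (w m))) (by fun_prop)
    have i4 := (h.integrable_pow m 4).mul_const (r ^ 4)
    have i01 := i0.fun_add i1
    have i02 := i01.fun_add i2
    have i03 := i02.fun_add i3
    rw [memLp_two_iff_integrable_sq (hmeas _ _)]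
    simp_rw [hexp]
    refine ⟨i03.fun_add i4, ?_⟩
    rw [integral_add i03 i4, integral_add i02 i3, integral_add i01 i2, integral_add i0 i1,
      e1, e2, e3, integral_mul_const, h.integral_pow m 4,
      integral_pow_three_gaussianReal, integral_pow_four_gaussianReal, integral_sq_gaussianReal,
      integral_sub j2' (integrable_const _), integral_add (hX1.const_mul _) (hL2.const_mul 4),
      integral_add k0 (integrable_const _),
      integral_sub hXsq (hX1.const_mul _), integral_const_mul, integral_const_mul,
      integral_const_mul, integral_const_mul, hX0]
    simp only [pow_one, integral_id_gaussianReal, integral_const, probReal_univ, smul_eq_mul]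
    have hs : (0 : ℝ) ≤ s := s.2
    have h5 := mul_le_mul_of_nonneg_left hL2i (mul_nonneg zero_le_four hs)
    rw [hc] at h5
    push_cast
    linarith

end IsGaussianIncrements

end Increments

/-! ### Pathwise convergence of Riemann–Stieltjes sums. -/

section RiemannStieltjes

open Filter Topology

/-- The points of the regular partition of `[-1/2, 1/2]` into `N` intervals. -/
noncomputable def gridPoint (N i : ℕ) : ℝ := (i : ℝ) / N - 1 / 2

lemma gridPoint_zero (N : ℕ) : gridPoint N 0 = -1 / 2 := by simp [gridPoint]; norm_num

lemma gridPoint_self {N : ℕ} (hN : 0 < N) : gridPoint N N = 1 / 2 := by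
  rw [gridPoint, div_self (by positivity)]; norm_num

lemma gridPoint_succ_sub (N i : ℕ) : gridPoint N (i + 1) - gridPoint N i = 1 / N := by
  simp only [gridPoint]; push_cast; ring

lemma gridPoint_mem {N i : ℕ} (hN : 0 < N) (hi : i ≤ N) :
    gridPoint N i ∈ Set.Icc (-1 / 2 : ℝ) (1 / 2) := by
  have hN' : (0 : ℝ) < N := by positivity
  have h1 : (i : ℝ) / N ≤ 1 := by rw [div_le_one hN']; exact_mod_cast hi
  have h2 : (0 : ℝ) ≤ (i : ℝ) / N := by positivity
  simp only [gridPoint, Set.mem_Icc]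
  constructor <;> linarith

/-- Abel summation moves the differences onto `χ`, so that continuity of `b` suffices later. -/
lemma sum_range_mul_sub_eq (N : ℕ) (b χ : ℕ → ℂ) :
    ∑ i ∈ Finset.range N, (b (i + 1) - b i) * χ i =
      χ N * b N - χ 0 * b 0 - ∑ i ∈ Finset.range N, (χ (i + 1) - χ i) * b (i + 1) := by
  rw [mul_comm (χ N), mul_comm (χ 0), ← Finset.sum_range_sub (fun i => b i * χ i),
    ← Finset.sum_sub_distrib]
  exact Finset.sum_congr rfl fun i _ => by ring

/-- Left Riemann sums of a `C¹` integrand against a continuous path converge to the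
Riemann–Stieltjes integral defined by integration by parts. -/
lemma tendsto_sum_derivPairing {b : ℝ → ℝ} (hb : Continuous b) {χ : ℝ → ℂ}
    (hχ : ContDiff ℝ 1 χ) :
    Tendsto (fun N : ℕ => ∑ i ∈ Finset.range N,
      ((b (gridPoint N (i + 1)) : ℂ) - b (gridPoint N i)) * χ (gridPoint N i)) atTop
      (𝓝 (derivPairing b χ)) := by
  have hχ' : Continuous (deriv χ) := hχ.continuous_deriv le_rfl
  obtain ⟨C, hC⟩ := isCompact_Icc.exists_bound_of_continuousOn
    (s := Set.Icc (-1 / 2 : ℝ) (1 / 2)) hχ'.continuousOn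
  have hC0 : 0 ≤ C := (norm_nonneg _).trans (hC 0 (by norm_num))
  have huc := isCompact_Icc.uniformContinuousOn_of_continuous
    (s := Set.Icc (-1 / 2 : ℝ) (1 / 2)) hb.continuousOn
  rw [Metric.tendsto_atTop]
  intro ε hε
  -- The total error will be at most `C · ε / (C + 1) < ε`, also when `C = 0`.
  obtain ⟨δ, hδ, hδb⟩ := Metric.uniformContinuousOn_iff.1 huc (ε / (C + 1)) (by positivity)
  obtain ⟨N₀, hN₀⟩ := exists_nat_one_div_lt hδ
  refine ⟨N₀ + 1, fun N hN => ?_⟩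
  have hNpos : 0 < N := by omega
  have hNR : (0 : ℝ) < N := by positivity
  have hNδ : 1 / (N : ℝ) < δ := by
    refine lt_of_le_of_lt ?_ hN₀
    apply one_div_le_one_div_of_le (by positivity)
    exact_mod_cast hN
  have hii : ∀ c : ℝ, ∀ u v, IntervalIntegrable (fun x => deriv χ x * ((b x : ℂ) - c))
      volume u v := fun c u v => Continuous.intervalIntegrable (by fun_prop) _ _
  -- The second integral is the error: it involves only the oscillation of `b` on one cell.
  have hlhs : ∀ i ∈ Finset.range N,
      (χ (gridPoint N (i + 1)) - χ (gridPoint N i)) * (b (gridPoint N (i + 1)) : ℂ) =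
        (∫ x in gridPoint N i..gridPoint N (i + 1), deriv χ x * (b x : ℂ)) -
        ∫ x in gridPoint N i..gridPoint N (i + 1),
          deriv χ x * ((b x : ℂ) - b (gridPoint N (i + 1))) := by
    intro i _
    rw [← intervalIntegral.integral_deriv_eq_sub
      (fun x _ => (hχ.differentiable one_ne_zero) x) (hχ'.intervalIntegrable _ _),
      ← intervalIntegral.integral_mul_const, ← intervalIntegral.integral_sub
      (Continuous.intervalIntegrable (by fun_prop) _ _) (hii _ _ _)]
    congr 1; ext x; ring
  have hsum := intervalIntegral.sum_integral_adjacent_intervals (μ := volume)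
    (f := fun x => deriv χ x * (b x : ℂ)) (a := gridPoint N) (n := N)
    (fun k _ => Continuous.intervalIntegrable (by fun_prop) _ _)
  rw [gridPoint_zero, gridPoint_self hNpos] at hsum
  rw [sum_range_mul_sub_eq N (fun i => (b (gridPoint N i) : ℂ)) (fun i => χ (gridPoint N i)),
    Finset.sum_congr rfl hlhs, Finset.sum_sub_distrib, hsum, derivPairing, gridPoint_zero,
    gridPoint_self hNpos, dist_eq_norm]
  have hbound : ∀ i ∈ Finset.range N, ‖∫ x in gridPoint N i..gridPoint N (i + 1),
      deriv χ x * ((b x : ℂ) - b (gridPoint N (i + 1)))‖ ≤ C * (ε / (C + 1)) * (1 / N) := by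
    intro i hi
    have hi' : i + 1 ≤ N := Finset.mem_range.1 hi
    have hd := gridPoint_succ_sub N i
    have hNi : (0 : ℝ) < 1 / N := by positivity
    have h1 := gridPoint_mem hNpos hi'
    have h0 := gridPoint_mem hNpos (Nat.le_of_succ_le hi')
    have key := intervalIntegral.norm_integral_le_of_norm_le_const
      (a := gridPoint N i) (b := gridPoint N (i + 1))
      (f := fun x => deriv χ x * ((b x : ℂ) - b (gridPoint N (i + 1))))
      (C := C * (ε / (C + 1))) (fun x hx => by
        rw [Set.uIoc_of_le (by linarith)] at hx
        have hxm : x ∈ Set.Icc (-1 / 2 : ℝ) (1 / 2) :=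
          ⟨h0.1.trans hx.1.le, hx.2.trans h1.2⟩
        rw [norm_mul]
        refine mul_le_mul (hC x hxm) ?_ (norm_nonneg _) hC0
        have := hδb x hxm _ h1 (by
          rw [Real.dist_eq, abs_lt]
          constructor <;> linarith [hx.1, hx.2])
        rw [Real.dist_eq] at this
        rw [← Complex.ofReal_sub, Complex.norm_real]
        exact this.le)
    rwa [hd, abs_of_pos hNi] at key
  have h2 := (norm_sum_le _ _).trans (Finset.sum_le_sum hbound)
  rw [Finset.sum_const, Finset.card_range, nsmul_eq_mul] at h2
  have h3 : (N : ℝ) * (C * (ε / (C + 1)) * (1 / N)) = C / (C + 1) * ε := by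
    field_simp
  have h4 : C / (C + 1) * ε < ε := by
    have : C / (C + 1) < 1 := by rw [div_lt_one (by positivity)]; linarith
    nlinarith
  refine lt_of_eq_of_lt ?_ (lt_of_le_of_lt (h2.trans_eq h3) h4)
  congr 1; ring

end RiemannStieltjes

/-! ### Translations in `L²(ℝ)` and `L²` representatives of distributions. -/

section L2

/-- The translate `u ↦ g (u - x)` of `g ∈ L²(ℝ)`. -/
noncomputable def translate (x : ℝ) (g : Lp ℂ 2 (volume : Measure ℝ)) :
    Lp ℂ 2 (volume : Measure ℝ) :=
  Lp.compMeasurePreserving (fun u => u - x) (measurePreserving_sub_right volume x) g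

lemma continuous_translate (g : Lp ℂ 2 (volume : Measure ℝ)) :
    Continuous fun x => translate x g := by
  have hc : Continuous fun x : ℝ => (⟨fun u : ℝ => u - x, by fun_prop⟩ : C(ℝ, ℝ)) :=
    ContinuousMap.continuous_of_continuous_uncurry _ (by
      simp only [Function.uncurry_def, ContinuousMap.coe_mk]; fun_prop)
  exact (continuous_const (y := g)).compMeasurePreservingLp hc
    (fun x => measurePreserving_sub_right volume x) (by simp)

lemma norm_translate (x : ℝ) (g : Lp ℂ 2 (volume : Measure ℝ)) : ‖translate x g‖ = ‖g‖ :=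
  Lp.norm_compMeasurePreserving _ _

lemma coeFn_translate (x : ℝ) (g : Lp ℂ 2 (volume : Measure ℝ)) :
    translate x g =ᵐ[volume] fun u => g (u - x) :=
  Lp.coeFn_compMeasurePreserving _ _

lemma coeFn_translate_toLp (x : ℝ) {g : ℝ → ℂ} (hg : MemLp g 2 volume) :
    translate x (hg.toLp g) =ᵐ[volume] fun u => g (u - x) :=
  (coeFn_translate x _).trans
    ((measurePreserving_sub_right volume x).quasiMeasurePreserving.ae_eq_comp hg.coeFn_toLp)

/-- As an inner product, the pairing with a test function passes through sums, Bochner integrals and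
`L²` limits. The representing vector is the conjugate of `φ`. -/
lemma exists_inner_eq_integral_mul {φ : ℝ → ℂ} (hφ : MemLp φ 2 volume) :
    ∃ Φ : Lp ℂ 2 (volume : Measure ℝ), ∀ g : Lp ℂ 2 (volume : Measure ℝ),
      inner ℂ Φ g = ∫ u, g u * φ u := by
  refine ⟨hφ.star.toLp _, fun g => ?_⟩
  rw [L2.inner_def]
  refine integral_congr_ae ?_
  filter_upwards [hφ.star.coeFn_toLp] with u hu
  rw [hu]
  simp

lemma norm_sq_eq_integral (g : Lp ℂ 2 (volume : Measure ℝ)) : ‖g‖ ^ 2 = ∫ u, ‖g u‖ ^ 2 := by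
  have h := L2.inner_def (𝕜 := ℂ) g g
  rw [inner_self_eq_norm_sq_to_K] at h
  simp_rw [inner_self_eq_norm_sq_to_K] at h
  have h2 : ((‖g‖ ^ 2 : ℝ) : ℂ) = ((∫ u, ‖g u‖ ^ 2 : ℝ) : ℂ) := by
    rw [← integral_complex_ofReal]
    simpa using h
  exact_mod_cast h2

lemma lintegral_enorm_sq_eq (g : Lp ℂ 2 (volume : Measure ℝ)) :
    ∫⁻ u, ‖g u‖ₑ ^ 2 = ENNReal.ofReal (‖g‖ ^ 2) := by
  rw [norm_sq_eq_integral, ofReal_integral_eq_lintegral_ofReal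
    ((memLp_two_iff_integrable_sq_norm (Lp.memLp g).1).1 (Lp.memLp g))
    (ae_of_all _ fun u => sq_nonneg _)]
  refine lintegral_congr fun u => ?_
  rw [ENNReal.ofReal_pow (norm_nonneg _), ofReal_norm]

lemma memLp_of_contDiff_hasCompactSupport {φ : ℝ → ℂ} (hφ : ContDiff ℝ (⊤ : ℕ∞) φ)
    (hs : HasCompactSupport φ) : MemLp φ 2 volume :=
  hφ.continuous.memLp_of_hasCompactSupport hs

lemma ae_eq_of_integral_mul_contDiff_eq {g h : ℝ → ℂ} (hg : LocallyIntegrable g volume)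
    (hh : LocallyIntegrable h volume)
    (H : ∀ φ : ℝ → ℂ, ContDiff ℝ (⊤ : ℕ∞) φ → HasCompactSupport φ →
      ∫ u, g u * φ u = ∫ u, h u * φ u) : g =ᵐ[volume] h := by
  refine ae_eq_of_integral_contDiff_smul_eq hg hh fun θ hθ hs => ?_
  have := H (fun u => (θ u : ℂ)) (Complex.ofRealCLM.contDiff.comp hθ)
    (hs.comp_left (g := fun x : ℝ => (x : ℂ)) (by simp))
  simpa [mul_comm] using this

/-- Test functions determine the representative up to null sets, so the infimum runs over a single
value. -/
lemma waveletInvariantDist_eq {ψ : ℝ → ℂ} {lam : ℝ} {T : (ℝ → ℂ) → ℂ}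
    {g : Lp ℂ 2 (volume : Measure ℝ)} (hg : IsL2Rep g (waveletConv ψ lam T)) :
    waveletInvariantDist ψ lam T = ENNReal.ofReal (‖g‖ ^ 2) := by
  rw [← lintegral_enorm_sq_eq]
  refine le_antisymm (iInf₂_le (g : ℝ → ℂ) hg) (le_iInf₂ fun h hh => le_of_eq ?_)
  have : g =ᵐ[volume] h := ae_eq_of_integral_mul_contDiff_eq
    (hg.1.locallyIntegrable one_le_two) (hh.1.locallyIntegrable one_le_two)
    fun φ h1 h2 => (hg.2 φ h1 h2).trans (hh.2 φ h1 h2).symm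
  refine lintegral_congr_ae ?_
  filter_upwards [this] with u hu
  rw [hu]

end L2

/-! ### Wavelet coefficients as elements of `L²(ℝ)`. -/

section Wavelet

variable {ψ : ℝ → ℂ} {lam : ℝ}

lemma IsWavelet.integrable_dilate (hψ : IsWavelet ψ) (hlam : 0 < lam) :
    Integrable (dilate ψ lam) volume :=
  (hψ.integrable.comp_mul_left' hlam.ne').const_mul _

lemma integral_norm_dilate_sq (ψ : ℝ → ℂ) (hlam : 0 < lam) :
    ∫ x, ‖dilate ψ lam x‖ ^ 2 = ∫ x, ‖ψ x‖ ^ 2 := by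
  have h : ∀ x, ‖dilate ψ lam x‖ ^ 2 = lam * ‖ψ (lam * x)‖ ^ 2 := fun x => by
    rw [dilate, norm_mul, mul_pow, Complex.norm_real, Real.norm_of_nonneg (Real.sqrt_nonneg _),
      Real.sq_sqrt hlam.le]
  simp_rw [h]
  rw [integral_const_mul, Measure.integral_comp_mul_left (fun x => ‖ψ x‖ ^ 2), smul_eq_mul,
    ← mul_assoc, abs_of_pos (inv_pos.2 hlam), mul_inv_cancel₀ hlam.ne', one_mul]

lemma IsWavelet.memLp_dilate (hψ : IsWavelet ψ) (hlam : 0 < lam) :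
    MemLp (dilate ψ lam) 2 volume := by
  have hm := (hψ.integrable_dilate hlam).1
  rw [memLp_two_iff_integrable_sq_norm hm]
  have h : (fun x => ‖dilate ψ lam x‖ ^ 2) = fun x => lam * ‖ψ (lam * x)‖ ^ 2 := by
    ext x
    rw [dilate, norm_mul, mul_pow, Complex.norm_real, Real.norm_of_nonneg (Real.sqrt_nonneg _),
      Real.sq_sqrt hlam.le]
  rw [h]
  exact (((memLp_two_iff_integrable_sq_norm hψ.memLp_two.1).1
    hψ.memLp_two).comp_mul_left' hlam.ne').const_mul _

/-- The dilated wavelet `ψ_λ` as an element of `L²(ℝ)`. -/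
noncomputable def IsWavelet.toL2 (hψ : IsWavelet ψ) (hlam : 0 < lam) :
    Lp ℂ 2 (volume : Measure ℝ) := (hψ.memLp_dilate hlam).toLp _

lemma IsWavelet.norm_toL2 (hψ : IsWavelet ψ) (hlam : 0 < lam) : ‖hψ.toL2 hlam‖ = 1 := by
  have h1 : ‖hψ.memLp_two.toLp ψ‖ = 1 := by rw [Lp.norm_toLp, hψ.norm_eq_one, ENNReal.toReal_one]
  have h2 : ∀ {g : ℝ → ℂ} (hg : MemLp g 2 volume), ‖hg.toLp g‖ ^ 2 = ∫ u, ‖g u‖ ^ 2 := by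
    intro g hg
    rw [norm_sq_eq_integral]
    refine integral_congr_ae ?_
    filter_upwards [hg.coeFn_toLp] with u hu
    rw [hu]
  have h3 := h2 (hψ.memLp_dilate hlam)
  rw [integral_norm_dilate_sq ψ hlam, ← h2 hψ.memLp_two, h1] at h3
  exact (sq_eq_sq₀ (norm_nonneg _) zero_le_one).1 h3

/-- The function against which the distribution is tested in `waveletConv`. -/
noncomputable def dualTransform (ψ : ℝ → ℂ) (lam : ℝ) (φ : ℝ → ℂ) (x : ℝ) : ℂ :=
  ∫ u : ℝ, dilate ψ lam (u - x) * φ u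

lemma IsWavelet.integral_translate_mul (hψ : IsWavelet ψ) (hlam : 0 < lam) (φ : ℝ → ℂ) (x : ℝ) :
    ∫ u, translate x (hψ.toL2 hlam) u * φ u = dualTransform ψ lam φ x := by
  refine integral_congr_ae ?_
  filter_upwards [coeFn_translate_toLp x (hψ.memLp_dilate hlam)] with u hu
  rw [IsWavelet.toL2, hu]

/-- This is the convolution of the reflected `ψ_λ` with `φ`; all the smoothness comes from `φ`. -/
lemma IsWavelet.contDiff_dualTransform (hψ : IsWavelet ψ) (hlam : 0 < lam) {φ : ℝ → ℂ}
    (hφ : ContDiff ℝ (⊤ : ℕ∞) φ) (hs : HasCompactSupport φ) :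
    ContDiff ℝ (⊤ : ℕ∞) (dualTransform ψ lam φ) := by
  have h := hs.contDiff_convolution_right (μ := volume) (ContinuousLinearMap.mul ℝ ℂ)
    (hψ.integrable_dilate hlam).comp_neg.locallyIntegrable hφ
  convert h using 1
  ext x
  rw [convolution_def, dualTransform, ← integral_sub_left_eq_self _ volume x]
  simp

lemma IsWavelet.integral_waveletTransform_mul (hψ : IsWavelet ψ) (hlam : 0 < lam) {f : ℝ → ℝ}
    (hf : Integrable f volume) {φ : ℝ → ℂ} (hφ : ContDiff ℝ (⊤ : ℕ∞) φ)
    (hs : HasCompactSupport φ) :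
    ∫ u, waveletTransform ψ lam f u * φ u = functionPairing f (dualTransform ψ lam φ) := by
  obtain ⟨C, hC⟩ := hs.exists_bound_of_continuous hφ.continuous
  have h1 := hf.ofReal (𝕜 := ℂ) |>.convolution_integrand (ContinuousLinearMap.mul ℝ ℂ)
    (hψ.integrable_dilate hlam)
  have h2 : Integrable (fun p : ℝ × ℝ => ((f p.2 : ℂ) * dilate ψ lam (p.1 - p.2)) * φ p.1)
      (volume.prod volume) :=
    Integrable.mul_bdd (c := C) h1 (hφ.continuous.comp continuous_fst).aestronglyMeasurable
      (ae_of_all _ fun p => hC p.1)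
  have h3 := integral_integral_swap
    (f := fun u x => ((f x : ℂ) * dilate ψ lam (u - x)) * φ u) h2
  simp only [functionPairing, waveletTransform, dualTransform, ← integral_const_mul,
    ← integral_mul_const, ← mul_assoc] at h3 ⊢
  exact h3

/-- `A` is the Bochner integral of `f(x)` times the translate of `ψ_λ` by `x`, a unit vector; this
is the source of `‖f‖₁` in the final bound. -/
lemma IsWavelet.exists_waveletTransform_ae_eq (hψ : IsWavelet ψ) (hlam : 0 < lam) {f : ℝ → ℝ}
    (hf : Integrable f volume) :
    ∃ A : Lp ℂ 2 (volume : Measure ℝ), waveletTransform ψ lam f =ᵐ[volume] A ∧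
      ‖A‖ ≤ ∫ x, |f x| := by
  have hS : ∀ x, ‖translate x (hψ.toL2 hlam)‖ = 1 := fun x => by
    rw [norm_translate, hψ.norm_toL2]
  have hi : Integrable (fun x => (f x : ℂ) • translate x (hψ.toL2 hlam)) volume := by
    refine (hf.norm).mono'
      (((hf.ofReal (𝕜 := ℂ)).1.smul
      (continuous_translate (hψ.toL2 hlam)).aestronglyMeasurable)) (ae_of_all _ fun x => ?_)
    rw [norm_smul, hS, mul_one, Complex.norm_real]
  refine ⟨∫ x, (f x : ℂ) • translate x (hψ.toL2 hlam), ?_, ?_⟩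
  · refine ae_eq_of_integral_mul_contDiff_eq ?_
      ((Lp.memLp _).locallyIntegrable one_le_two) fun φ hφ hs => ?_
    · exact ((hf.ofReal (𝕜 := ℂ)).integrable_convolution (ContinuousLinearMap.mul ℝ ℂ)
        (hψ.integrable_dilate hlam)).locallyIntegrable
    · obtain ⟨Φ, hΦ⟩ := exists_inner_eq_integral_mul (memLp_of_contDiff_hasCompactSupport hφ hs)
      rw [hψ.integral_waveletTransform_mul hlam hf hφ hs, ← hΦ, ← integral_inner hi]
      simp_rw [inner_smul_right, hΦ, hψ.integral_translate_mul hlam]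
      rfl
  · refine (norm_integral_le_integral_norm _).trans_eq (integral_congr_ae (ae_of_all _ fun x => ?_))
    dsimp only
    rw [norm_smul, hS, mul_one, Complex.norm_real, Real.norm_eq_abs]

lemma waveletTransform_comp_sub (ψ : ℝ → ℂ) (lam : ℝ) (f : ℝ → ℝ) (τ u : ℝ) :
    waveletTransform ψ lam (fun x => f (x - τ)) u = waveletTransform ψ lam f (u - τ) := by
  rw [waveletTransform, waveletTransform,
    ← integral_sub_right_eq_self (fun x => (f x : ℂ) * dilate ψ lam (u - τ - x)) τ]
  simp

lemma waveletInvariant_eq {f : ℝ → ℝ} {A : Lp ℂ 2 (volume : Measure ℝ)}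
    (hA : waveletTransform ψ lam f =ᵐ[volume] A) : waveletInvariant ψ lam f = ‖A‖ ^ 2 := by
  rw [norm_sq_eq_integral]
  refine integral_congr_ae ?_
  filter_upwards [hA] with u hu
  rw [hu]

lemma IsWavelet.waveletInvariantDist_observation (hψ : IsWavelet ψ) (hlam : 0 < lam) {f : ℝ → ℝ}
    (hf : Integrable f volume) {A Z : Lp ℂ 2 (volume : Measure ℝ)}
    (hA : waveletTransform ψ lam f =ᵐ[volume] A) {σ τ : ℝ} {b : ℝ≥0 → ℝ}
    (hZ : ∀ φ : ℝ → ℂ, ContDiff ℝ (⊤ : ℕ∞) φ → HasCompactSupport φ →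
      ∫ u, Z u * φ u = derivPairing (noisePath σ b) (dualTransform ψ lam φ)) :
    waveletInvariantDist ψ lam (observation f σ τ b) =
      ENNReal.ofReal (‖translate τ A + Z‖ ^ 2) := by
  refine waveletInvariantDist_eq ⟨Lp.memLp _, fun φ hφ hs => ?_⟩
  have hτ : translate τ A =ᵐ[volume] waveletTransform ψ lam (fun x => f (x - τ)) := by
    refine (coeFn_translate τ A).trans ?_
    filter_upwards [(measurePreserving_sub_right volume τ).quasiMeasurePreserving.ae_eq_comp hA]
      with u hu
    rw [waveletTransform_comp_sub]
    exact hu.symm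
  obtain ⟨Φ, hΦ⟩ := exists_inner_eq_integral_mul (memLp_of_contDiff_hasCompactSupport hφ hs)
  rw [← hΦ, inner_add_right, hΦ, hΦ, hZ φ hφ hs]
  have : ∫ u, translate τ A u * φ u =
      ∫ u, waveletTransform ψ lam (fun x => f (x - τ)) u * φ u := by
    refine integral_congr_ae ?_
    filter_upwards [hτ] with u hu
    rw [hu]
  rw [this, hψ.integral_waveletTransform_mul hlam (hf.comp_sub_right τ) hφ hs]
  rfl

end Wavelet

/-! ### Independence of pairs, almost sure summability, and Chebyshev's inequality through a limit.
-/

section Probability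

lemma comap_prodMk_eq_generateFrom {Ω α γ : Type*} [MeasurableSpace α] [MeasurableSpace γ]
    (X : Ω → α) (Y : Ω → γ) :
    MeasurableSpace.comap (fun ω => (X ω, Y ω)) inferInstance =
      MeasurableSpace.generateFrom (Set.preimage (fun ω => (X ω, Y ω)) ''
        Set.image2 (· ×ˢ ·) {s : Set α | MeasurableSet s} {t : Set γ | MeasurableSet t}) := by
  rw [← MeasurableSpace.comap_generateFrom, generateFrom_prod]

variable {Ω : Type*} [MeasurableSpace Ω] {P : Measure Ω}

lemma ae_summable_of_lintegral_le {D : ℕ → Ω → ℝ} (hD : ∀ k, Measurable (D k))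
    (h0 : ∀ k ω, 0 ≤ D k ω) {c : ℕ → ℝ} (hc : Summable c)
    (hDc : ∀ k, ∫⁻ ω, ENNReal.ofReal (D k ω) ∂P ≤ ENNReal.ofReal (c k)) :
    ∀ᵐ ω ∂P, Summable fun k => D k ω := by
  have h1 : ∫⁻ ω, ∑' k, ENNReal.ofReal (D k ω) ∂P ≠ ∞ := by
    rw [lintegral_tsum fun k => (hD k).ennreal_ofReal.aemeasurable]
    exact ne_top_of_le_ne_top hc.tsum_ofReal_ne_top (ENNReal.tsum_le_tsum hDc)
  filter_upwards [ae_lt_top (Measurable.tsum fun k => (hD k).ennreal_ofReal) h1]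
    with ω hω
  have := ENNReal.summable_toReal hω.ne
  simpa [ENNReal.toReal_ofReal (h0 _ _)] using this

variable [IsProbabilityMeasure P]

/-- On rectangles all probabilities factor into four, and the factors can be regrouped; rectangles
form a generating π-system. -/
lemma indepFun_prodMk_prodMk {α β γ δ : Type*} [MeasurableSpace α] [MeasurableSpace β]
    [MeasurableSpace γ] [MeasurableSpace δ] {X₁ : Ω → α} {X₂ : Ω → β} {Y₁ : Ω → γ} {Y₂ : Ω → δ}
    (hX₁ : Measurable X₁) (hX₂ : Measurable X₂) (hY₁ : Measurable Y₁) (hY₂ : Measurable Y₂)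
    (h : IndepFun (fun ω => (X₁ ω, X₂ ω)) (fun ω => (Y₁ ω, Y₂ ω)) P)
    (hX : IndepFun X₁ X₂ P) (hY : IndepFun Y₁ Y₂ P) :
    IndepFun (fun ω => (X₁ ω, Y₁ ω)) (fun ω => (X₂ ω, Y₂ ω)) P := by
  rw [IndepFun_iff_Indep]
  refine IndepSets.indep (hX₁.prodMk hY₁).comap_le (hX₂.prodMk hY₂).comap_le
    (isPiSystem_prod.comap _) (isPiSystem_prod.comap _) (comap_prodMk_eq_generateFrom X₁ Y₁)
    (comap_prodMk_eq_generateFrom X₂ Y₂) ?_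
  rw [IndepSets_iff]
  rintro _ _ ⟨_, ⟨a, ha, c, hc, rfl⟩, rfl⟩ ⟨_, ⟨b, hb, d, hd, rfl⟩, rfl⟩
  have ha : MeasurableSet a := ha
  have hb : MeasurableSet b := hb
  have hc : MeasurableSet c := hc
  have hd : MeasurableSet d := hd
  have hXY : ∀ {a b c d}, MeasurableSet a → MeasurableSet b → MeasurableSet c → MeasurableSet d →
      P (((fun ω => (X₁ ω, Y₁ ω)) ⁻¹' (a ×ˢ c)) ∩ ((fun ω => (X₂ ω, Y₂ ω)) ⁻¹' (b ×ˢ d))) =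
      P (X₁ ⁻¹' a) * P (X₂ ⁻¹' b) * (P (Y₁ ⁻¹' c) * P (Y₂ ⁻¹' d)) := by
    intro a b c d ha hb hc hd
    have e := h.measure_inter_preimage_eq_mul _ _ (ha.prod hb) (hc.prod hd)
    rw [Set.mk_preimage_prod, Set.mk_preimage_prod] at e
    rw [← hX.measure_inter_preimage_eq_mul _ _ ha hb, ← hY.measure_inter_preimage_eq_mul _ _ hc hd,
      ← e]
    congr 1
    ext ω
    simp only [Set.mem_inter_iff, Set.mem_preimage, Set.mem_prod]
    tauto
  have e1 := hXY ha MeasurableSet.univ hc MeasurableSet.univ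
  have e2 := hXY MeasurableSet.univ hb MeasurableSet.univ hd
  simp only [Set.univ_prod_univ, Set.preimage_univ, Set.inter_univ, Set.univ_inter, measure_univ,
    mul_one, one_mul] at e1 e2
  rw [e1, e2, hXY ha hb hc hd, mul_mul_mul_comm]

lemma one_sub_le_measureReal_of_tendsto {X : ℕ → Ω → ℝ} {Y : Ω → ℝ} {C K t : ℝ}
    (hX : ∀ k, MemLp (X k) 2 P) (hXC : ∀ k, ∫ ω, X k ω ^ 2 ∂P ≤ C)
    (hlim : ∀ᵐ ω ∂P, Filter.Tendsto (fun k => X k ω) Filter.atTop (nhds (Y ω)))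
    (hK : 0 ≤ K) (hCK : C ≤ K ^ 2) (ht : 0 < t) :
    1 - 1 / t ^ 2 ≤ P.real {ω | |Y ω| ≤ t * K} := by
  have hYm : AEMeasurable Y P :=
    aemeasurable_of_tendsto_metrizable_ae _ (fun k => (hX k).1.aemeasurable) hlim
  have hfatou : ∫⁻ ω, ENNReal.ofReal (Y ω ^ 2) ∂P ≤ ENNReal.ofReal (K ^ 2) := by
    calc ∫⁻ ω, ENNReal.ofReal (Y ω ^ 2) ∂P
        = ∫⁻ ω, Filter.liminf (fun k => ENNReal.ofReal (X k ω ^ 2)) Filter.atTop ∂P := by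
          refine lintegral_congr_ae ?_
          filter_upwards [hlim] with ω hω
          exact (((ENNReal.continuous_ofReal.tendsto _).comp (hω.pow 2)).liminf_eq).symm
      _ ≤ Filter.liminf (fun k => ∫⁻ ω, ENNReal.ofReal (X k ω ^ 2) ∂P) Filter.atTop :=
          lintegral_liminf_le' fun k => ((hX k).1.aemeasurable.pow_const 2).ennreal_ofReal
      _ ≤ ENNReal.ofReal (K ^ 2) := by
          refine Filter.liminf_le_of_frequently_le' (Filter.Frequently.of_forall fun k => ?_)
          rw [← ofReal_integral_eq_lintegral_ofReal (hX k).integrable_sq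
            (ae_of_all _ fun ω => sq_nonneg _)]
          exact ENNReal.ofReal_le_ofReal ((hXC k).trans hCK)
  have hcompl : P.real {ω | |Y ω| ≤ t * K}ᶜ ≤ 1 / t ^ 2 := by
    -- The case `K = 0`, which occurs when `σ = 0`, would make Markov's inequality divide by zero;
    -- there `Y` vanishes almost surely.
    rcases hK.eq_or_lt with rfl | hK
    · have h0 : ∫⁻ ω, ENNReal.ofReal (Y ω ^ 2) ∂P = 0 := by simpa using hfatou
      rw [lintegral_eq_zero_iff' (hYm.pow_const 2).ennreal_ofReal] at h0
      have : P {ω | |Y ω| ≤ t * 0}ᶜ = 0 := by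
        change ∀ᵐ ω ∂P, |Y ω| ≤ t * 0
        filter_upwards [h0] with ω hω
        have h1 : Y ω ^ 2 ≤ 0 := by simpa using hω
        have h2 : Y ω = 0 := by nlinarith
        simp [h2]
      rw [measureReal_def, this]
      simp; positivity
    · have hpos : 0 < (t * K) ^ 2 := by positivity
      have h1 := meas_ge_le_lintegral_div (hYm.pow_const 2).ennreal_ofReal
        (ENNReal.ofReal_pos.2 hpos).ne' ENNReal.ofReal_ne_top
      have h2 : P {ω | |Y ω| ≤ t * K}ᶜ ≤ ENNReal.ofReal (1 / t ^ 2) := by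
        refine (measure_mono fun ω hω => ?_).trans (h1.trans
          ((ENNReal.div_le_div_right hfatou _).trans_eq ?_))
        · have h3 : t * K < |Y ω| := not_le.1 hω
          refine ENNReal.ofReal_le_ofReal ?_
          rw [← sq_abs (Y ω)]
          exact pow_le_pow_left₀ (by positivity) h3.le 2
        · rw [← ENNReal.ofReal_div_of_pos hpos]
          congr 1
          field_simp
      exact ENNReal.toReal_le_of_le_ofReal (by positivity) h2
  -- Subadditivity is enough, and the event need not be measurable.
  have htot : 1 ≤ P.real {ω | |Y ω| ≤ t * K} + P.real {ω | |Y ω| ≤ t * K}ᶜ := by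
    have := measureReal_union_le (μ := P) {ω | |Y ω| ≤ t * K} {ω | |Y ω| ≤ t * K}ᶜ
    rwa [Set.union_compl_self, probReal_univ] at this
  linarith

end Probability

/-! ### Brownian increments on regular grids. -/

section BrownianIncrements

/-- The increment of the path `b` over the `i`-th of the intervals of length `1 / N`. -/
noncomputable def increment (b : ℝ≥0 → ℝ) (N i : ℕ) : ℝ :=
  b (((i + 1 : ℕ) : ℝ≥0) / N) - b ((i : ℝ≥0) / N)

variable {Ω : Type*} [MeasurableSpace Ω] {P : Measure Ω} [IsProbabilityMeasure P]

lemma isGaussianIncrements_increment {T : Ω → ℝ} {B : ℝ≥0 → Ω → ℝ} (hT : Measurable T)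
    (hBm : ∀ s, Measurable (B s)) (hB : IsPreBrownianReal B P)
    (hTB : IndepFun T (fun ω s => B s ω) P) {N : ℕ} (hN : 0 < N) :
    IsGaussianIncrements P T (fun i ω => increment (fun s => B s ω) N i) (1 / (N : ℝ≥0)) := by
  have hsucc : ∀ i : ℕ, (((i + 1 : ℕ) : ℝ≥0) / N) = (i : ℝ≥0) / N + 1 / N := fun i => by
    push_cast; rw [add_div]
  have hmeas : ∀ i, Measurable fun ω => increment (fun s => B s ω) N i := fun i =>
    (hBm _).sub (hBm _)
  refine ⟨hT, hmeas, fun i => ?_, fun i => ?_⟩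
  · have h := hB.hasLaw_sub (((i + 1 : ℕ) : ℝ≥0) / N) ((i : ℝ≥0) / N)
    have hd : nndist (((((i + 1 : ℕ) : ℝ≥0) / N : ℝ≥0)) : ℝ) (((i : ℝ≥0) / N : ℝ≥0) : ℝ)
        = 1 / (N : ℝ≥0) := by
      apply NNReal.coe_injective
      rw [coe_nndist, Real.dist_eq, hsucc, NNReal.coe_add, add_sub_cancel_left, NNReal.abs_eq]
    have h' : HasLaw (B (((i + 1 : ℕ) : ℝ≥0) / N) - B ((i : ℝ≥0) / N))
      (gaussianReal 0 (nndist (((((i + 1 : ℕ) : ℝ≥0) / N : ℝ≥0)) : ℝ)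
        (((i : ℝ≥0) / N : ℝ≥0) : ℝ))) P := h
    rw [hd] at h'
    exact h'
  · set past : Ω → (Set.Iic ((i : ℝ≥0) / N) → ℝ) := fun ω t => B t ω
    have hpast : Measurable past := measurable_pi_lambda _ fun t => hBm _
    have h1 : IndepFun (fun ω => increment (fun s => B s ω) N i) past P := by
      have := (hB.indepFun_shift ((i : ℝ≥0) / N)).comp
        (measurable_pi_apply (1 / (N : ℝ≥0))) measurable_id
      simp only [increment, hsucc]
      exact this
    -- The dummy constant brings the data into the form of `indepFun_prodMk_prodMk`, which combines
    -- independence of `T` from the path with that of the increment from the past.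
    have h2 : IndepFun (fun ω => ((), T ω))
        (fun ω => (increment (fun s => B s ω) N i, past ω)) P :=
      hTB.comp (φ := fun x => ((), x)) (ψ := fun b : ℝ≥0 → ℝ =>
        (increment b N i, fun t : Set.Iic ((i : ℝ≥0) / N) => b t)) (by fun_prop)
        (by unfold increment; fun_prop)
    have h3 := indepFun_prodMk_prodMk measurable_const hT (hmeas i) hpast h2
      (indepFun_const_left () T) h1
    have hle : ∀ k, k ≤ i → ((k : ℕ) : ℝ≥0) / N ≤ (i : ℝ≥0) / N := fun k hk => by gcongr
    exact h3.comp (φ := Prod.snd) (ψ := fun p : ℝ × (Set.Iic ((i : ℝ≥0) / N) → ℝ) =>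
      (p.1, fun k : Fin i => p.2 ⟨(((k : ℕ) + 1 : ℕ) : ℝ≥0) / N, hle _ k.2⟩
        - p.2 ⟨((k : ℕ) : ℝ≥0) / N, hle _ k.2.le⟩)) measurable_snd (by fun_prop)

lemma sum_range_mul_eq {V : Type*} [AddCommMonoid V] (F : ℕ → V) (N q : ℕ) :
    ∑ i ∈ Finset.range (N * q), F i =
      ∑ i ∈ Finset.range N, ∑ j ∈ Finset.range q, F (i * q + j) := by
  induction N with
  | zero => simp
  | succ N ih => rw [Nat.succ_mul, Finset.sum_range_add, ih, Finset.sum_range_succ]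

/-- A Riemann sum may be computed on a refinement of the partition. -/
lemma sum_increment_smul_eq {V : Type*} [AddCommGroup V] [Module ℂ V] (b : ℝ≥0 → ℝ) (w : ℕ → V)
    (N : ℕ) {q : ℕ} (hq : 0 < q) :
    ∑ i ∈ Finset.range N, (increment b N i : ℂ) • w i =
      ∑ i ∈ Finset.range (N * q), (increment b (N * q) i : ℂ) • w (i / q) := by
  rw [sum_range_mul_eq]
  refine Finset.sum_congr rfl fun i _ => ?_
  have h1 : ∀ j ∈ Finset.range q, (increment b (N * q) (i * q + j) : ℂ) • w ((i * q + j) / q) =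
      (increment b (N * q) (i * q + j) : ℂ) • w i := fun j hj => by
    rw [Nat.mul_comm i q, Nat.mul_add_div hq, Nat.div_eq_of_lt (Finset.mem_range.1 hj), add_zero]
  rw [Finset.sum_congr rfl h1, ← Finset.sum_smul, ← Complex.ofReal_sum]
  have h2 : ∑ j ∈ Finset.range q, increment b (N * q) (i * q + j) = increment b N i := by
    have h3 := Finset.sum_range_sub
      (fun j => b (((i * q + j : ℕ) : ℝ≥0) / ((N * q : ℕ) : ℝ≥0))) q
    have hq' : (q : ℝ≥0) ≠ 0 := by positivity
    have e1 : ((i * q + q : ℕ) : ℝ≥0) / ((N * q : ℕ) : ℝ≥0) = ((i + 1 : ℕ) : ℝ≥0) / N := by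
      rw [← Nat.succ_mul, Nat.cast_mul, Nat.cast_mul, mul_div_mul_right _ _ hq']
    have e2 : ((i * q + 0 : ℕ) : ℝ≥0) / ((N * q : ℕ) : ℝ≥0) = (i : ℝ≥0) / N := by
      rw [add_zero, Nat.cast_mul, Nat.cast_mul, mul_div_mul_right _ _ hq']
    rw [e1, e2] at h3
    exact h3
  rw [h2]

lemma noisePath_gridPoint (σ : ℝ) (b : ℝ≥0 → ℝ) (N i : ℕ) :
    noisePath σ b (gridPoint N i) = σ * b ((i : ℝ≥0) / N) := by
  rw [noisePath, gridPoint, sub_add_cancel]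
  congr 2
  apply NNReal.coe_injective
  rw [Real.coe_toNNReal _ (by positivity)]
  simp

end BrownianIncrements

/-! ### Convergence of the Riemann sums to the observed wavelet coefficients. -/

section Observation

variable {ψ : ℝ → ℂ} {lam : ℝ}

/-- The weights of the Riemann sum of the noisy wavelet coefficients. -/
noncomputable def IsWavelet.gridWeight (hψ : IsWavelet ψ) (hlam : 0 < lam) (σ : ℝ) (N i : ℕ) :
    Lp ℂ 2 (volume : Measure ℝ) :=
  (σ : ℂ) • translate (gridPoint N i) (hψ.toL2 hlam)

lemma IsWavelet.norm_gridWeight (hψ : IsWavelet ψ) (hlam : 0 < lam) {σ : ℝ} (hσ : 0 ≤ σ)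
    (N i : ℕ) : ‖hψ.gridWeight hlam σ N i‖ = σ := by
  rw [gridWeight, norm_smul, norm_translate, hψ.norm_toL2, mul_one, Complex.norm_real,
    Real.norm_of_nonneg hσ]

/-- Uniform continuity of translation on a compact interval. Dyadic grids are nested, and one
subsequence serves all observations. -/
lemma IsWavelet.exists_subsequence_translate (hψ : IsWavelet ψ) (hlam : 0 < lam) :
    ∃ n : ℕ → ℕ, StrictMono n ∧ ∀ k, ∀ x ∈ Set.Icc (-1 / 2 : ℝ) (1 / 2),
      ∀ y ∈ Set.Icc (-1 / 2 : ℝ) (1 / 2), |x - y| ≤ 1 / (2 ^ n k : ℕ) →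
      ‖translate x (hψ.toL2 hlam) - translate y (hψ.toL2 hlam)‖ ≤ (1 / 2) ^ k := by
  have huc := isCompact_Icc.uniformContinuousOn_of_continuous
    (s := Set.Icc (-1 / 2 : ℝ) (1 / 2)) (continuous_translate (hψ.toL2 hlam)).continuousOn
  refine Filter.extraction_forall_of_eventually (P := fun k m =>
    ∀ x ∈ Set.Icc (-1 / 2 : ℝ) (1 / 2), ∀ y ∈ Set.Icc (-1 / 2 : ℝ) (1 / 2),
      |x - y| ≤ 1 / (2 ^ m : ℕ) →
      ‖translate x (hψ.toL2 hlam) - translate y (hψ.toL2 hlam)‖ ≤ (1 / 2) ^ k) fun k => ?_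
  obtain ⟨δ, hδ, h⟩ := Metric.uniformContinuousOn_iff.1 huc ((1 / 2) ^ k) (by positivity)
  have hlim : Filter.Tendsto (fun n : ℕ => (1 / 2 : ℝ) ^ n) Filter.atTop (nhds 0) :=
    tendsto_pow_atTop_nhds_zero_of_lt_one (by norm_num) (by norm_num)
  filter_upwards [hlim.eventually_lt_const hδ] with n hn x hx y hy hxy
  rw [← dist_eq_norm]
  refine (h x hx y hy (lt_of_le_of_lt ?_ hn)).le
  rw [Real.dist_eq]
  simpa using hxy

lemma abs_gridPoint_sub_le {N q i : ℕ} (hN : 0 < N) (hq : 0 < q) :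
    |gridPoint (N * q) i - gridPoint N (i / q)| ≤ 1 / N := by
  have hN' : (0 : ℝ) < N := by positivity
  have hq' : (0 : ℝ) < q := by positivity
  have h1 : ((i / q : ℕ) : ℝ) * q ≤ i := by exact_mod_cast Nat.div_mul_le_self i q
  have h2 : (i : ℝ) ≤ ((i / q : ℕ) : ℝ) * q + q := by
    exact_mod_cast (Nat.lt_div_mul_add hq).le
  have e : gridPoint (N * q) i - gridPoint N (i / q) =
      (i - ((i / q : ℕ) : ℝ) * q) / (N * q) := by
    simp only [gridPoint]; push_cast; field_simp; ring
  rw [e, abs_of_nonneg (div_nonneg (by linarith) (by positivity)),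
    div_le_div_iff₀ (by positivity) hN']
  nlinarith

variable {Ω : Type*}

/-- The Riemann sum approximation of the wavelet coefficients of an observation. -/
noncomputable def IsWavelet.noisyWalk (hψ : IsWavelet ψ) (hlam : 0 < lam)
    (A : Lp ℂ 2 (volume : Measure ℝ)) (σ : ℝ) (T : Ω → ℝ) (B : ℝ≥0 → Ω → ℝ) (N : ℕ) (ω : Ω) :
    Lp ℂ 2 (volume : Measure ℝ) :=
  walk (fun x => translate x A) (hψ.gridWeight hlam σ N) T
    (fun i ω => increment (fun s => B s ω) N i) N ω

/-- The signal parts cancel and the difference is again a walk, so its second moment is given by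
`integral_norm_walk_sq`. -/
lemma IsWavelet.noisyWalk_mul_sub (hψ : IsWavelet ψ) (hlam : 0 < lam)
    (A : Lp ℂ 2 (volume : Measure ℝ)) (σ : ℝ) (T : Ω → ℝ) (B : ℝ≥0 → Ω → ℝ) (N : ℕ) {q : ℕ}
    (hq : 0 < q) (ω : Ω) :
    hψ.noisyWalk hlam A σ T B (N * q) ω - hψ.noisyWalk hlam A σ T B N ω =
      walk (fun _ => (0 : Lp ℂ 2 (volume : Measure ℝ)))
        (fun i => hψ.gridWeight hlam σ (N * q) i - hψ.gridWeight hlam σ N (i / q)) T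
        (fun i ω => increment (fun s => B s ω) (N * q) i) (N * q) ω := by
  simp only [noisyWalk, walk, add_sub_add_left_eq_sub, zero_add]
  rw [sum_increment_smul_eq _ _ N hq, ← Finset.sum_sub_distrib]
  exact Finset.sum_congr rfl fun i _ => (smul_sub _ _ _).symm

/-- If the Riemann sums converge in `L²(ℝ)`, then the limit represents the distribution. -/
lemma IsWavelet.waveletInvariantDist_of_tendsto (hψ : IsWavelet ψ) (hlam : 0 < lam) {f : ℝ → ℝ}
    (hf : Integrable f volume) {A : Lp ℂ 2 (volume : Measure ℝ)}
    (hA : waveletTransform ψ lam f =ᵐ[volume] A) {σ : ℝ} {T : Ω → ℝ} {B : ℝ≥0 → Ω → ℝ}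
    {n : ℕ → ℕ} (hn : StrictMono n) {ω : Ω} (hcont : Continuous fun s => B s ω)
    {Y : Lp ℂ 2 (volume : Measure ℝ)} (hY : Filter.Tendsto
      (fun k => hψ.noisyWalk hlam A σ T B (2 ^ n k) ω) Filter.atTop (nhds Y)) :
    waveletInvariantDist ψ lam (observation f σ (T ω) (fun s => B s ω)) =
      ENNReal.ofReal (‖Y‖ ^ 2) := by
  have key := hψ.waveletInvariantDist_observation hlam hf hA (σ := σ) (τ := T ω)
    (b := fun s => B s ω) (Z := Y - translate (T ω) A) fun φ hφ hs => ?_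
  · rwa [add_sub_cancel] at key
  obtain ⟨Φ, hΦ⟩ := exists_inner_eq_integral_mul (memLp_of_contDiff_hasCompactSupport hφ hs)
  rw [← hΦ]
  have hb : Continuous (noisePath σ fun s => B s ω) := by
    unfold noisePath
    exact continuous_const.mul (hcont.comp (continuous_real_toNNReal.comp (by fun_prop)))
  have hlim := (tendsto_sum_derivPairing hb ((hψ.contDiff_dualTransform hlam hφ hs).of_le
    (by exact_mod_cast le_top))).comp ((tendsto_pow_atTop_atTop_of_one_lt
      (one_lt_two : (1 : ℕ) < 2)).comp hn.tendsto_atTop)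
  have hlim' := ((continuous_const (y := Φ)).inner (𝕜 := ℂ) continuous_id).tendsto
    (Y - translate (T ω) A) |>.comp (hY.sub_const (translate (T ω) A))
  -- The paired Riemann sums have two limits, one from `L²` convergence and one pathwise; they must
  -- agree.
  refine tendsto_nhds_unique hlim' (hlim.congr fun k => ?_)
  simp only [Function.comp_apply, noisyWalk, walk, add_sub_cancel_left, id, inner_sum,
    inner_smul_right, gridWeight, noisePath_gridPoint]
  refine Finset.sum_congr rfl fun i _ => ?_
  rw [hΦ, hψ.integral_translate_mul hlam, increment]
  push_cast
  ring

variable [MeasurableSpace Ω] {P : Measure Ω}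

lemma IsWavelet.integral_noisyWalk_mul_sub_sq_le [IsProbabilityMeasure P] (hψ : IsWavelet ψ)
    (hlam : 0 < lam) (A : Lp ℂ 2 (volume : Measure ℝ)) (σ : ℝ) {T : Ω → ℝ} {B : ℝ≥0 → Ω → ℝ}
    (hT : Measurable T) (hBm : ∀ s, Measurable (B s)) (hB : IsPreBrownianReal B P)
    (hTB : IndepFun T (fun ω s => B s ω) P) {N q : ℕ} (hN : 0 < N) (hq : 0 < q) {ε : ℝ}
    (hε : ∀ x ∈ Set.Icc (-1 / 2 : ℝ) (1 / 2), ∀ y ∈ Set.Icc (-1 / 2 : ℝ) (1 / 2),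
      |x - y| ≤ 1 / N → ‖translate x (hψ.toL2 hlam) - translate y (hψ.toL2 hlam)‖ ≤ ε) :
    (Measurable fun ω =>
      ‖hψ.noisyWalk hlam A σ T B (N * q) ω - hψ.noisyWalk hlam A σ T B N ω‖ ^ 2) ∧
    ∫⁻ ω, ENNReal.ofReal
      (‖hψ.noisyWalk hlam A σ T B (N * q) ω - hψ.noisyWalk hlam A σ T B N ω‖ ^ 2) ∂P ≤
      ENNReal.ofReal (σ ^ 2 * ε ^ 2) := by
  have hNq : 0 < N * q := Nat.mul_pos hN hq
  have hG := isGaussianIncrements_increment hT hBm hB hTB hNq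
  simp_rw [hψ.noisyWalk_mul_sub hlam A σ T B N hq]
  set w : ℕ → Lp ℂ 2 (volume : Measure ℝ) := fun i =>
    hψ.gridWeight hlam σ (N * q) i - hψ.gridWeight hlam σ N (i / q) with hw
  obtain ⟨h1, h2⟩ := hG.integral_norm_walk_sq
    (a := fun _ => (0 : Lp ℂ 2 (volume : Measure ℝ))) continuous_const
    (α := 0) (fun _ => norm_zero) w (N * q)
  refine ⟨hG.measurable_comp_walk (a := fun _ => (0 : Lp ℂ 2 (volume : Measure ℝ)))
    continuous_const w (N * q) (g := fun y => ‖y‖ ^ 2) (by fun_prop), ?_⟩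
  rw [← ofReal_integral_eq_lintegral_ofReal h1 (ae_of_all _ fun _ => sq_nonneg _), h2]
  refine ENNReal.ofReal_le_ofReal ?_
  have hwle : ∀ i ∈ Finset.range (N * q), ‖w i‖ ^ 2 ≤ σ ^ 2 * ε ^ 2 := by
    intro i hi
    have hi' := Finset.mem_range.1 hi
    simp only [hw, gridWeight]
    rw [← smul_sub, norm_smul, Complex.norm_real, Real.norm_eq_abs, mul_pow, sq_abs]
    refine mul_le_mul_of_nonneg_left (pow_le_pow_left₀ (norm_nonneg _)
      (hε _ (gridPoint_mem hNq hi'.le) _ (gridPoint_mem hN ?_)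
        (abs_gridPoint_sub_le hN hq)) 2) (sq_nonneg _)
    exact (Nat.div_lt_of_lt_mul (by rwa [mul_comm])).le
  have h3 := Finset.sum_le_sum hwle
  rw [Finset.sum_const, Finset.card_range, nsmul_eq_mul] at h3
  have hpos : (0 : ℝ) < (N * q : ℕ) := by exact_mod_cast hNq
  have h4 : ((1 / ((N * q : ℕ) : ℝ≥0) : ℝ≥0) : ℝ) = 1 / ((N * q : ℕ) : ℝ) := by
    simp
  rw [h4]
  calc (0 : ℝ) ^ 2 + 1 / ((N * q : ℕ) : ℝ) * ∑ i ∈ Finset.range (N * q), ‖w i‖ ^ 2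
      ≤ 0 ^ 2 + 1 / ((N * q : ℕ) : ℝ) * (((N * q : ℕ) : ℝ) * (σ ^ 2 * ε ^ 2)) := by gcongr
    _ = σ ^ 2 * ε ^ 2 := by field_simp; ring

/-- Along a subsequence of partitions that depends on the wavelet only, the Riemann sums converge
almost surely in `L²(ℝ)`. -/
lemma IsWavelet.ae_exists_tendsto_noisyWalk [IsProbabilityMeasure P] (hψ : IsWavelet ψ)
    (hlam : 0 < lam) (A : Lp ℂ 2 (volume : Measure ℝ)) (σ : ℝ) {T : Ω → ℝ} {B : ℝ≥0 → Ω → ℝ}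
    (hT : Measurable T) (hBm : ∀ s, Measurable (B s)) (hB : IsPreBrownianReal B P)
    (hTB : IndepFun T (fun ω s => B s ω) P) {n : ℕ → ℕ} (hn : StrictMono n)
    (hnS : ∀ k, ∀ x ∈ Set.Icc (-1 / 2 : ℝ) (1 / 2), ∀ y ∈ Set.Icc (-1 / 2 : ℝ) (1 / 2),
      |x - y| ≤ 1 / (2 ^ n k : ℕ) →
      ‖translate x (hψ.toL2 hlam) - translate y (hψ.toL2 hlam)‖ ≤ (1 / 2) ^ k) :
    ∀ᵐ ω ∂P, ∃ Y : Lp ℂ 2 (volume : Measure ℝ), Filter.Tendsto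
      (fun k => hψ.noisyWalk hlam A σ T B (2 ^ n k) ω) Filter.atTop (nhds Y) := by
  have hstep : ∀ k, (2 : ℕ) ^ n (k + 1) = 2 ^ n k * 2 ^ (n (k + 1) - n k) := fun k => by
    rw [← pow_add, Nat.add_sub_cancel' (hn k.lt_succ_self).le]
  have hk := fun k => hψ.integral_noisyWalk_mul_sub_sq_le hlam A σ hT hBm hB hTB
    (N := 2 ^ n k) (q := 2 ^ (n (k + 1) - n k)) (by positivity) (by positivity) (hnS k)
  simp_rw [← hstep] at hk
  -- The squared steps have mean at most `σ² 4⁻ᵏ`, so the weight `2 ^ k` still leaves a summable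
  -- series.
  have hsum := ae_summable_of_lintegral_le (P := P) (D := fun k ω => 2 ^ k *
      ‖hψ.noisyWalk hlam A σ T B (2 ^ n (k + 1)) ω - hψ.noisyWalk hlam A σ T B (2 ^ n k) ω‖ ^ 2)
    (fun k => (hk k).1.const_mul _) (fun k ω => by positivity)
    (c := fun k => σ ^ 2 * (1 / 2) ^ k)
    ((summable_geometric_of_lt_one (by norm_num) (by norm_num)).mul_left _) fun k => by
      simp_rw [ENNReal.ofReal_mul (pow_nonneg zero_le_two k : (0 : ℝ) ≤ 2 ^ k)]
      rw [lintegral_const_mul _ (hk k).1.ennreal_ofReal]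
      refine (mul_le_mul_right (hk k).2 _).trans_eq ?_
      rw [← ENNReal.ofReal_mul (by positivity)]
      congr 1
      have : (2 : ℝ) ^ k * (1 / 2) ^ k = 1 := by rw [← mul_pow]; norm_num
      linear_combination (σ ^ 2 * (1 / 2) ^ k) * this
  filter_upwards [hsum] with ω hω
  refine cauchySeq_tendsto_of_complete (cauchySeq_of_summable_dist ?_)
  refine Summable.of_nonneg_of_le (fun _ => dist_nonneg) (fun k => ?_)
    (hω.add (summable_geometric_of_lt_one (r := (1 / 2 : ℝ)) (by norm_num) (by norm_num)))
  rw [dist_comm, dist_eq_norm]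
  set d := ‖hψ.noisyWalk hlam A σ T B (2 ^ n (k + 1)) ω
    - hψ.noisyWalk hlam A σ T B (2 ^ n k) ω‖
  have h2 : (2 : ℝ) ^ k * (1 / 2) ^ k = 1 := by rw [← mul_pow]; norm_num
  have hp : (0 : ℝ) < 2 ^ k := by positivity
  have hd : 0 ≤ d := norm_nonneg _
  -- Completing the square gives `2d ≤ 2ᵏ d² + 2⁻ᵏ`, which dominates the distances by a summable
  -- series.
  have hsq : 0 ≤ 2 ^ k * (d - (1 / 2) ^ k) ^ 2 := by positivity
  have e : (2 : ℝ) ^ k * (d - (1 / 2) ^ k) ^ 2 = 2 ^ k * d ^ 2 - 2 * d + (1 / 2) ^ k := by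
    linear_combination (-2 * d + (1 / 2) ^ k) * h2
  change d ≤ 2 ^ k * d ^ 2 + (1 / 2) ^ k
  linarith

end Observation

/-! ### Moment bounds for the model, and the theorem. -/

section Main

variable {Ω : Type*} {ψ : ℝ → ℂ} {lam : ℝ}

/-- The same `F` serves every `T` and `B`, so independence of the pairs `(τ j, B j)` passes to the
squared norms. -/
lemma IsWavelet.exists_measurable_noisyWalk (hψ : IsWavelet ψ) (hlam : 0 < lam)
    (A : Lp ℂ 2 (volume : Measure ℝ)) (σ : ℝ) (N : ℕ) :
    ∃ F : ℝ × (ℝ≥0 → ℝ) → ℝ, Measurable F ∧ ∀ (T : Ω → ℝ) (B : ℝ≥0 → Ω → ℝ) (ω : Ω),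
      ‖hψ.noisyWalk hlam A σ T B N ω‖ ^ 2 = F (T ω, fun s => B s ω) := by
  have hc : Continuous fun p : ℝ × (Fin N → ℝ) =>
      ‖translate p.1 A + ∑ k : Fin N, (p.2 k : ℂ) • hψ.gridWeight hlam σ N k‖ ^ 2 := by
    have := (continuous_translate A).comp (continuous_fst (X := ℝ) (Y := Fin N → ℝ))
    exact (this.add (by fun_prop)).norm.pow 2
  refine ⟨_, hc.measurable.comp (g := fun p => _) (f := fun p : ℝ × (ℝ≥0 → ℝ) =>
    (p.1, fun k : Fin N => increment p.2 N k)) (by unfold increment; fun_prop), fun T B ω => ?_⟩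
  simp [noisyWalk, walk, Finset.sum_range]

variable [MeasurableSpace Ω] {P : Measure Ω}

lemma IsClassicMRA.indepFun {M : ℕ} {f : ℝ → ℝ} {σ : ℝ} {τ : Fin M → Ω → ℝ}
    {B : Fin M → ℝ≥0 → Ω → ℝ} (h : IsClassicMRA P f σ τ B) (j : Fin M) :
    IndepFun (τ j) (fun ω s => B j s ω) P :=
  h.translation_noise_indep.comp (measurable_pi_apply j) (measurable_pi_apply j)

variable [IsProbabilityMeasure P]

/-- There are `N` increments of variance `1 / N`, so the mesh drops out of the mean and of the
variance bound. -/
lemma IsWavelet.integral_noisyWalk_sub_sq_le (hψ : IsWavelet ψ)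
    (hlam : 0 < lam) (A : Lp ℂ 2 (volume : Measure ℝ)) {σ : ℝ} (hσ : 0 ≤ σ) {T : Ω → ℝ}
    {B : ℝ≥0 → Ω → ℝ} (hT : Measurable T) (hBm : ∀ s, Measurable (B s))
    (hB : IsPreBrownianReal B P) (hTB : IndepFun T (fun ω s => B s ω) P) {N : ℕ} (hN : 0 < N) :
    MemLp (fun ω => ‖hψ.noisyWalk hlam A σ T B N ω‖ ^ 2 - (‖A‖ ^ 2 + σ ^ 2)) 2 P ∧
    ∫ ω, (‖hψ.noisyWalk hlam A σ T B N ω‖ ^ 2 - (‖A‖ ^ 2 + σ ^ 2)) ∂P = 0 ∧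
    ∫ ω, (‖hψ.noisyWalk hlam A σ T B N ω‖ ^ 2 - (‖A‖ ^ 2 + σ ^ 2)) ^ 2 ∂P ≤
      4 * ‖A‖ ^ 2 * σ ^ 2 + 2 * σ ^ 4 := by
  have h := (isGaussianIncrements_increment hT hBm hB hTB hN).integral_walk_sub_sq_le
    (continuous_translate A) (fun x => norm_translate x A) (hψ.norm_gridWeight hlam hσ N) N
  have hN' : (N : ℝ) ≠ 0 := by positivity
  have e : ((1 / (N : ℝ≥0) : ℝ≥0) : ℝ) = 1 / (N : ℝ) := by simp
  have e1 : 1 / (N : ℝ) * N = 1 := one_div_mul_cancel hN'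
  rw [e, e1, ← mul_assoc, e1, one_mul, mul_one, one_pow, mul_one] at h
  exact h

lemma IsClassicMRA.indepFun_pair {M : ℕ} {f : ℝ → ℝ} {σ : ℝ} {τ : Fin M → Ω → ℝ}
    {B : Fin M → ℝ≥0 → Ω → ℝ} (h : IsClassicMRA P f σ τ B) {i j : Fin M} (hij : i ≠ j) :
    IndepFun (fun ω => (τ i ω, fun s => B i s ω)) (fun ω => (τ j ω, fun s => B j s ω)) P :=
  indepFun_prodMk_prodMk (h.translation_measurable i) (h.translation_measurable j)
    (measurable_pi_lambda _ fun s => h.noise_measurable i s)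
    (measurable_pi_lambda _ fun s => h.noise_measurable j s)
    (h.translation_noise_indep.comp (φ := fun x : Fin M → ℝ => (x i, x j))
      (ψ := fun b : Fin M → ℝ≥0 → ℝ => (b i, b j)) (by fun_prop) (by fun_prop))
    (h.translation_indep.indepFun hij) (h.noise_indep.indepFun hij)

lemma IsWavelet.integral_sum_noisyWalk_sq_le (hψ : IsWavelet ψ) (hlam : 0 < lam)
    (A : Lp ℂ 2 (volume : Measure ℝ)) {M : ℕ} {f : ℝ → ℝ} {σ : ℝ} {τ : Fin M → Ω → ℝ}
    {B : Fin M → ℝ≥0 → Ω → ℝ} (h : IsClassicMRA P f σ τ B) {N : ℕ} (hN : 0 < N) :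
    MemLp (fun ω => ∑ j, (‖hψ.noisyWalk hlam A σ (τ j) (B j) N ω‖ ^ 2 - (‖A‖ ^ 2 + σ ^ 2))) 2 P ∧
    ∫ ω, (∑ j, (‖hψ.noisyWalk hlam A σ (τ j) (B j) N ω‖ ^ 2 - (‖A‖ ^ 2 + σ ^ 2))) ^ 2 ∂P ≤
      M * (4 * ‖A‖ ^ 2 * σ ^ 2 + 2 * σ ^ 4) := by
  have hX := fun j => hψ.integral_noisyWalk_sub_sq_le hlam A h.sigma_nonneg
    (h.translation_measurable j) (h.noise_measurable j) (h.noise_brownian j).toIsPreBrownianReal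
    (h.indepFun j) hN
  set X : Fin M → Ω → ℝ := fun j ω =>
    ‖hψ.noisyWalk hlam A σ (τ j) (B j) N ω‖ ^ 2 - (‖A‖ ^ 2 + σ ^ 2) with hXdef
  have hmem : ∀ j, MemLp (X j) 2 P := fun j => (hX j).1
  have hmean : ∀ j, ∫ ω, X j ω ∂P = 0 := fun j => (hX j).2.1
  obtain ⟨F, hF, hFe⟩ := hψ.exists_measurable_noisyWalk (Ω := Ω) hlam A σ N
  have hind : Set.Pairwise (↑(Finset.univ : Finset (Fin M))) fun i j =>
      IndepFun (X i) (X j) P := by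
    intro i _ j _ hij
    have := (h.indepFun_pair hij).comp (hF.sub_const (‖A‖ ^ 2 + σ ^ 2))
      (hF.sub_const (‖A‖ ^ 2 + σ ^ 2))
    simp only [hXdef, hFe]
    exact this
  have hvar := IndepFun.variance_sum (fun j _ => hmem j) hind
  have hsum : MemLp (∑ j, X j) 2 P := memLp_finsetSum' _ fun j _ => hmem j
  have hsum0 : ∫ ω, (∑ j, X j) ω ∂P = 0 := by
    simp_rw [Finset.sum_apply]
    rw [integral_finsetSum _ fun j _ => (hmem j).integrable one_le_two]
    exact Finset.sum_eq_zero fun j _ => hmean j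
  rw [variance_of_integral_eq_zero hsum.1.aemeasurable hsum0] at hvar
  have e : (∑ j, X j) = fun ω => ∑ j, X j ω := by ext ω; simp
  rw [e] at hsum hvar
  refine ⟨hsum, hvar.trans_le ?_⟩
  have hle : ∀ j ∈ Finset.univ, variance (X j) P ≤ 4 * ‖A‖ ^ 2 * σ ^ 2 + 2 * σ ^ 4 := fun j _ => by
    rw [variance_of_integral_eq_zero (hmem j).1.aemeasurable (hmean j)]
    exact (hX j).2.2
  refine (Finset.sum_le_sum hle).trans_eq ?_
  rw [Finset.sum_const, Finset.card_univ, Fintype.card_fin, nsmul_eq_mul]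

end Main

end MRA

theorem mainTheorem4 {Ω : Type*} [MeasurableSpace Ω] (P : Measure Ω) [IsProbabilityMeasure P]
    (ψ : ℝ → ℂ) (hψ : MRA.IsWavelet ψ)
    (M : ℕ) (hM : 0 < M) (f : ℝ → ℝ) (σ : ℝ) (τ : Fin M → Ω → ℝ) (B : Fin M → ℝ≥0 → Ω → ℝ)
    (hmodel : MRA.IsClassicMRA P f σ τ B)
    (lam : ℝ) (hlam : 0 < lam) (t : ℝ) (ht : 0 < t) :
    (∀ j : Fin M,
      AEMeasurable (fun ω => MRA.waveletInvariantDist ψ lam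
        (MRA.observation f σ (τ j ω) (fun s => B j s ω))) P ∧
      ∀ᵐ ω ∂P, MRA.waveletInvariantDist ψ lam
        (MRA.observation f σ (τ j ω) (fun s => B j s ω)) < ∞) ∧
    1 - 1 / t ^ 2 ≤ P.real {ω | |MRA.waveletInvariant ψ lam f
        - MRA.estimator ψ lam f σ τ B ω| ≤
          2 * t * σ / Real.sqrt M * ((∫ x, |f x|) + σ)} := by
  have hf : Integrable f volume :=
    ((hmodel.signal_memLp.locallyIntegrable one_le_two).integrableOn_isCompact
      hmodel.signal_hasCompactSupport).integrable_of_forall_notMem_eq_zero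
      fun x hx => image_eq_zero_of_notMem_tsupport hx
  obtain ⟨A, hA, hAf⟩ := hψ.exists_waveletTransform_ae_eq hlam hf
  obtain ⟨n, hn, hnS⟩ := hψ.exists_subsequence_translate hlam
  have hlim : ∀ j, ∀ᵐ ω ∂P, MRA.waveletInvariantDist ψ lam
      (MRA.observation f σ (τ j ω) (fun s => B j s ω)) < ∞ ∧
      Filter.Tendsto (fun k => ‖hψ.noisyWalk hlam A σ (τ j) (B j) (2 ^ n k) ω‖ ^ 2) Filter.atTop
        (nhds (MRA.waveletInvariantDist ψ lam
          (MRA.observation f σ (τ j ω) (fun s => B j s ω))).toReal) := by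
    intro j
    filter_upwards [hψ.ae_exists_tendsto_noisyWalk hlam A σ (hmodel.translation_measurable j)
      (hmodel.noise_measurable j) (hmodel.noise_brownian j).toIsPreBrownianReal
      (hmodel.indepFun j) hn hnS, (hmodel.noise_brownian j).cont] with ω ⟨Y, hY⟩ hcont
    rw [hψ.waveletInvariantDist_of_tendsto hlam hf hA hn hcont hY]
    refine ⟨ENNReal.ofReal_lt_top, ?_⟩
    rw [ENNReal.toReal_ofReal (sq_nonneg _)]
    exact hY.norm.pow 2
  have hpow : ∀ k, 0 < 2 ^ n k := fun k => by positivity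
  refine ⟨fun j => ⟨?_, (hlim j).mono fun ω h => h.1⟩, ?_⟩
  · obtain h := fun k => hψ.exists_measurable_noisyWalk (Ω := Ω) hlam A σ (2 ^ n k)
    choose F hF hFe using h
    have hm : AEMeasurable (fun ω => (MRA.waveletInvariantDist ψ lam
        (MRA.observation f σ (τ j ω) (fun s => B j s ω))).toReal) P := by
      refine aemeasurable_of_tendsto_metrizable_ae Filter.atTop (fun k => Measurable.aemeasurable ?_)
        ((hlim j).mono fun ω h => h.2)
      simp_rw [hFe]
      exact (hF k).comp ((hmodel.translation_measurable j).prodMk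
        (measurable_pi_lambda _ fun s => hmodel.noise_measurable j s))
    refine hm.ennreal_ofReal.congr ?_
    filter_upwards [hlim j] with ω h
    exact ENNReal.ofReal_toReal h.1.ne
  · have hX := fun k => hψ.integral_sum_noisyWalk_sq_le hlam A hmodel (hpow k)
    have hMpos : (0 : ℝ) < M := by exact_mod_cast hM
    have hf0 : 0 ≤ ∫ x, |f x| := integral_nonneg fun x => abs_nonneg _
    have hσ := hmodel.sigma_nonneg
    have hdev := MRA.one_sub_le_measureReal_of_tendsto (P := P) (t := t)
      (C := (1 / M : ℝ) ^ 2 * (M * (4 * ‖A‖ ^ 2 * σ ^ 2 + 2 * σ ^ 4)))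
      (K := 2 * σ / Real.sqrt M * ((∫ x, |f x|) + σ))
      (Y := fun ω => MRA.estimator ψ lam f σ τ B ω - MRA.waveletInvariant ψ lam f)
      (fun k => (hX k).1.const_mul (1 / M : ℝ))
      (fun k => by
        simp_rw [mul_pow]
        rw [integral_const_mul]
        exact mul_le_mul_of_nonneg_left (hX k).2 (sq_nonneg _)) ?_ (by positivity) ?_ ht
    · have e : t * (2 * σ / Real.sqrt M * ((∫ x, |f x|) + σ)) =
          2 * t * σ / Real.sqrt M * ((∫ x, |f x|) + σ) := by ring
      simp_rw [e] at hdev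
      simp_rw [abs_sub_comm (MRA.waveletInvariant ψ lam f)]
      exact hdev
    · filter_upwards [ae_all_iff.2 hlim] with ω h
      -- Since `(S f)(λ) = ‖A‖²`, the averaged centred squared norms converge to the error of the
      -- estimator.
      have h1 := (tendsto_finsetSum Finset.univ fun j _ =>
        ((h j).2.sub_const (‖A‖ ^ 2 + σ ^ 2))).const_mul (1 / M : ℝ)
      convert h1 using 2
      rw [MRA.estimator, MRA.waveletInvariant_eq hA, Finset.sum_sub_distrib]
      simp only [Finset.sum_const, Finset.card_univ, Fintype.card_fin, nsmul_eq_mul]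
      field_simp
      ring
    · have hK : (2 * σ / Real.sqrt M * ((∫ x, |f x|) + σ)) ^ 2 =
          4 * σ ^ 2 / M * ((∫ x, |f x|) + σ) ^ 2 := by
        rw [mul_pow, div_pow, Real.sq_sqrt hMpos.le]; ring
      have hA2 : ‖A‖ ^ 2 ≤ (∫ x, |f x|) ^ 2 := pow_le_pow_left₀ (norm_nonneg _) hAf 2
      -- Expanding the right side leaves the spare terms `8σ³‖f‖₁` and `2σ⁴`, both nonnegative.
      have hle : 4 * ‖A‖ ^ 2 * σ ^ 2 + 2 * σ ^ 4 ≤ 4 * σ ^ 2 * ((∫ x, |f x|) + σ) ^ 2 := by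
        nlinarith [mul_le_mul_of_nonneg_left hA2 (sq_nonneg σ),
          mul_nonneg (mul_nonneg (sq_nonneg σ) hf0) hσ, sq_nonneg (σ ^ 2)]
      rw [hK]
      calc (1 / M : ℝ) ^ 2 * (M * (4 * ‖A‖ ^ 2 * σ ^ 2 + 2 * σ ^ 4))
          = (4 * ‖A‖ ^ 2 * σ ^ 2 + 2 * σ ^ 4) / M := by field_simp
        _ ≤ (4 * σ ^ 2 * ((∫ x, |f x|) + σ) ^ 2) / M := by gcongr
        _ = 4 * σ ^ 2 / M * ((∫ x, |f x|) + σ) ^ 2 := by ring
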